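/- For $n\ge 1$ let $$s=s_n=\frac{1}{\sqrt{2\pi}}\sqrt{\frac{\log(2(2n+1))}{\pi}},\qquad C_s=\frac1{2s}[-1,1]^n,\qquad D=\Big(\frac1s\mathbb Z^n\Big)\cap\big(C_s+2\sqrt n\,B_2^n\big),$$ where $B_2^n$ is the closed Euclidean unit ball. Let $\gamma_n(x)=(2\pi)^{-n/2}e^{-\|x\|^2/2}$ be the standard Gaussian density on $\mathbb R^n$ and put $p_x=\int_{C_s}\gamma_n(x+y)\,dy$. A symmetric convex body $K\subset\mathbb R^n$ is a compact convex set with non-empty interior and $K=-K$; $\|x\|_K=\inf\{r>0: x\in rK\}$ is its norm, and $$\ell(K)=\int_{\mathbb R^n}\|x\|_K\,\gamma_n(x)\,dx,\qquad \tilde\ell(K)=\sum_{x\in D}p_x\|x\|_K .$$ (i) For every $n\ge1$ the set $D$ is finite, and for every symmetric convex body $K\subset\mathbb R^n$ the integral defining $\ell(K)$ converges and $$\Big(1-\frac1s\Big)\ell(K)\le\tilde\ell(K)\le\Big(1+\frac1s\Big)\ell(K).$$ (ii) The estimate $\tilde\ell(K)$ is computable deterministically in $O(\sqrt{\log n})^n$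 time: there is an absolute constant $C>0$ such that $|D|\le (C\sqrt{\log n})^n$ for all $n\ge2$, and there is one deterministic program which, for every $n\ge1$ and every symmetric convex body $K\subset\mathbb R^n$, given $n$ and an oracle that returns $\|x\|_K$ for a queried $x\in\mathbb R^n$, halts with output $\tilde\ell(K)$, after at most $(C\sqrt{\log n})^n$ steps if $n\ge 2$. Here programs run on a random access machine with an integer memory and a real memory. Each memory access, integer addition or subtraction, conversion of an integer to a real, real arithmetic operation, comparison, use of an integer or rational constant or of $\pi$, and evaluation of $\sqrt{\cdot}$, $\log$ or the one-dimensional standard normal distribution function costs one step, and an oracle query costs $n+1$ steps (further bounded bookkeeping per executed command is charged as well). -/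

import Mathlib

open MeasureTheory
open scoped Pointwise

noncomputable section

namespace EllEstimate

/-! ### Gaussian expected norm of a symmetric convex body -/

/-- A symmetric convex body in `ℝⁿ`: compact, convex, with non-empty interior, and `K = -K`. -/
structure IsSymmConvexBody {n : ℕ} (K : Set (EuclideanSpace ℝ (Fin n))) : Prop where
  convex : Convex ℝ K
  compact : IsCompact K
  interior_nonempty : (interior K).Nonempty
  symm : ∀ x ∈ K, -x ∈ K

/-- The standard Gaussian density `γₙ(x) = (1/√(2π))ⁿ exp(-‖x‖²/2)`. -/
def gaussDensity {n : ℕ} (x : EuclideanSpace ℝ (Fin n)) : ℝ :=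
  (1 / Real.sqrt (2 * Real.pi)) ^ n * Real.exp (-(1 / 2) * ‖x‖ ^ 2)

/-- `ℓ(K) = ∫ ‖x‖_K γₙ(x) dx`, where `‖·‖_K` is the Minkowski gauge of `K`. -/
def ell {n : ℕ} (K : Set (EuclideanSpace ℝ (Fin n))) : ℝ :=
  ∫ x, gauge K x * gaussDensity x

/-! ### The discrete estimate -/

/-- `s = (1/√(2π)) √(log(2(2n+1))/π)`. -/
def scale (n : ℕ) : ℝ :=
  1 / Real.sqrt (2 * Real.pi) * Real.sqrt (Real.log (2 * (2 * (n : ℝ) + 1)) / Real.pi)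

/-- The cube `C_s = (1/(2s)) [-1,1]ⁿ`. -/
def cell (n : ℕ) : Set (EuclideanSpace ℝ (Fin n)) :=
  (1 / (2 * scale n)) • {y | ∀ i, y i ∈ Set.Icc (-1 : ℝ) 1}

/-- The lattice `(1/s) ℤⁿ`. -/
def grid (n : ℕ) : Set (EuclideanSpace ℝ (Fin n)) :=
  (1 / scale n) • {y | ∀ i, ∃ k : ℤ, y i = (k : ℝ)}

/-- `D = (1/s) ℤⁿ ∩ (C_s + 2√n B₂ⁿ)`. -/
def samplePoints (n : ℕ) : Set (EuclideanSpace ℝ (Fin n)) :=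
  grid n ∩ (cell n + Metric.closedBall 0 (2 * Real.sqrt n))

/-- `p_x = ∫_{C_s} γₙ(x + y) dy`. -/
def weight {n : ℕ} (x : EuclideanSpace ℝ (Fin n)) : ℝ :=
  ∫ y in cell n, gaussDensity (x + y)

/-- `ℓ̃(K) = ∑_{x ∈ D} p_x ‖x‖_K`. -/
def ellTilde {n : ℕ} (K : Set (EuclideanSpace ℝ (Fin n))) : ℝ :=
  ∑ᶠ x ∈ samplePoints n, weight x * gauge K x

/-! ### A uniform real-number machine with a norm oracle and a step count

Programs are finite texts in a deterministic imperative language, with an integer memory and a real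
memory (both with computed addresses).  Each arithmetic operation, memory access, comparison and
evaluation of `√`, `log` or the normal distribution function counts one step. -/

/-- The two memories. -/
structure Store where
  int : ℕ → ℤ
  real : ℕ → ℝ

/-- Integer expressions; `load e` reads the integer memory at the address given by `e`. -/
inductive IExp where
  | const (k : ℤ)
  | load (e : IExp)
  | plus (e f : IExp)
  | minus (e f : IExp)

def IExp.eval (σ : Store) : IExp → ℤ
  | .const k => k
  | .load e => σ.int (e.eval σ).toNat
  | .plus e f => e.eval σ + f.eval σ
  | .minus e f => e.eval σ - f.eval σ

def IExp.cost : IExp → ℕ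
  | .const _ => 1
  | .load e => e.cost + 1
  | .plus e f => e.cost + f.cost + 1
  | .minus e f => e.cost + f.cost + 1

/-- Real expressions; the only constants are rational numbers and `π`. `normalCdf` is the
distribution function of the one-dimensional standard Gaussian. -/
inductive RExp where
  | const (q : ℚ)
  | pi
  | load (e : IExp)
  | ofInt (e : IExp)
  | plus (a b : RExp)
  | minus (a b : RExp)
  | times (a b : RExp)
  | over (a b : RExp)
  | sqrt (a : RExp)
  | log (a : RExp)
  | normalCdf (a : RExp)

def RExp.eval (σ : Store) : RExp → ℝ
  | .const q => q
  | .pi => Real.pi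
  | .load e => σ.real (e.eval σ).toNat
  | .ofInt e => (e.eval σ : ℝ)
  | .plus a b => a.eval σ + b.eval σ
  | .minus a b => a.eval σ - b.eval σ
  | .times a b => a.eval σ * b.eval σ
  | .over a b => a.eval σ / b.eval σ
  | .sqrt a => Real.sqrt (a.eval σ)
  | .log a => Real.log (a.eval σ)
  | .normalCdf a => ProbabilityTheory.cdf (ProbabilityTheory.gaussianReal 0 1) (a.eval σ)

def RExp.cost : RExp → ℕ
  | .const _ => 1
  | .pi => 1
  | .load e => e.cost + 1
  | .ofInt e => e.cost + 1
  | .plus a b => a.cost + b.cost + 1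
  | .minus a b => a.cost + b.cost + 1
  | .times a b => a.cost + b.cost + 1
  | .over a b => a.cost + b.cost + 1
  | .sqrt a => a.cost + 1
  | .log a => a.cost + 1
  | .normalCdf a => a.cost + 1

/-- Tests. -/
inductive Test where
  | ile (e f : IExp)
  | rle (a b : RExp)
  | neg (t : Test)
  | both (t u : Test)

def Test.holds (σ : Store) : Test → Prop
  | .ile e f => e.eval σ ≤ f.eval σ
  | .rle a b => a.eval σ ≤ b.eval σ
  | .neg t => ¬ t.holds σ
  | .both t u => t.holds σ ∧ u.holds σ

def Test.cost : Test → ℕ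
  | .ile e f => e.cost + f.cost + 1
  | .rle a b => a.cost + b.cost + 1
  | .neg t => t.cost + 1
  | .both t u => t.cost + u.cost + 1

/-- Commands. `query dst src` asks the oracle for the norm of the vector stored in the real memory
at the addresses `src, …, src + n - 1`, and stores the answer at the address `dst`. -/
inductive Cmd where
  | skip
  | setInt (addr e : IExp)
  | setReal (addr : IExp) (a : RExp)
  | query (dst src : IExp)
  | seq (c d : Cmd)
  | cond (t : Test) (c d : Cmd)
  | loop (t : Test) (c : Cmd)

def Store.setInt (σ : Store) (i : ℕ) (v : ℤ) : Store :=
  { σ with int := Function.update σ.int i v }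

def Store.setReal (σ : Store) (i : ℕ) (v : ℝ) : Store :=
  { σ with real := Function.update σ.real i v }

/-- The vector in `ℝⁿ` stored in the real memory from address `a` on. -/
def Store.vec (n : ℕ) (σ : Store) (a : ℕ) : EuclideanSpace ℝ (Fin n) :=
  WithLp.toLp 2 (fun i : Fin n => σ.real (a + i))

/-- `Exec K c σ τ t`: with the oracle `x ↦ ‖x‖_K`, the command `c` started in the store `σ`
halts in the store `τ` after exactly `t` steps. A query costs one step for each coordinate read,
plus one step for the call. -/
inductive Exec {n : ℕ} (K : Set (EuclideanSpace ℝ (Fin n))) :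
    Cmd → Store → Store → ℕ → Prop where
  | skip (σ : Store) : Exec K .skip σ σ 1
  | setInt (addr e : IExp) (σ : Store) :
      Exec K (.setInt addr e) σ (σ.setInt (addr.eval σ).toNat (e.eval σ))
        (addr.cost + e.cost + 1)
  | setReal (addr : IExp) (a : RExp) (σ : Store) :
      Exec K (.setReal addr a) σ (σ.setReal (addr.eval σ).toNat (a.eval σ))
        (addr.cost + a.cost + 1)
  | query (dst src : IExp) (σ : Store) :
      Exec K (.query dst src) σ
        (σ.setReal (dst.eval σ).toNat (gauge K (σ.vec n (src.eval σ).toNat)))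
        (dst.cost + src.cost + n + 1)
  | seq {c d : Cmd} {σ τ υ : Store} {t u : ℕ} :
      Exec K c σ τ t → Exec K d τ υ u → Exec K (.seq c d) σ υ (t + u)
  | condTrue {b : Test} {c d : Cmd} {σ τ : Store} {t : ℕ} :
      b.holds σ → Exec K c σ τ t → Exec K (.cond b c d) σ τ (b.cost + t)
  | condFalse {b : Test} {c d : Cmd} {σ τ : Store} {t : ℕ} :
      ¬ b.holds σ → Exec K d σ τ t → Exec K (.cond b c d) σ τ (b.cost + t)
  | loopDone {b : Test} {c : Cmd} {σ : Store} :
      ¬ b.holds σ → Exec K (.loop b c) σ σ b.cost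
  | loopStep {b : Test} {c : Cmd} {σ τ υ : Store} {t u : ℕ} :
      b.holds σ → Exec K c σ τ t → Exec K (.loop b c) τ υ u →
      Exec K (.loop b c) σ υ (b.cost + t + u)

/-- The execution is deterministic: final store and step count are determined by the input. -/
theorem Exec.unique {n : ℕ} {K : Set (EuclideanSpace ℝ (Fin n))} {c : Cmd} {σ τ τ' : Store}
    {t t' : ℕ} (h : Exec K c σ τ t) (h' : Exec K c σ τ' t') : τ = τ' ∧ t = t' := by
  induction h generalizing τ' t' with
  | skip σ => cases h'; exact ⟨rfl, rfl⟩
  | setInt addr e σ => cases h'; exact ⟨rfl, rfl⟩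
  | setReal addr a σ => cases h'; exact ⟨rfl, rfl⟩
  | query dst src σ => cases h'; exact ⟨rfl, rfl⟩
  | seq _ _ ih1 ih2 =>
    cases h' with
    | seq g1 g2 =>
      obtain ⟨rfl, rfl⟩ := ih1 g1
      obtain ⟨rfl, rfl⟩ := ih2 g2
      exact ⟨rfl, rfl⟩
  | condTrue hb _ ih =>
    cases h' with
    | condTrue _ g => obtain ⟨rfl, rfl⟩ := ih g; exact ⟨rfl, rfl⟩
    | condFalse nb _ => exact absurd hb nb
  | condFalse hb _ ih =>
    cases h' with
    | condTrue nb _ => exact absurd nb hb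
    | condFalse _ g => obtain ⟨rfl, rfl⟩ := ih g; exact ⟨rfl, rfl⟩
  | loopDone hb =>
    cases h' with
    | loopDone _ => exact ⟨rfl, rfl⟩
    | loopStep nb _ _ => exact absurd nb hb
  | loopStep hb _ _ ih1 ih2 =>
    cases h' with
    | loopDone nb => exact absurd hb nb
    | loopStep _ g1 g2 =>
      obtain ⟨rfl, rfl⟩ := ih1 g1
      obtain ⟨rfl, rfl⟩ := ih2 g2
      exact ⟨rfl, rfl⟩

/-- The initial store: the dimension `n` at integer address `0`, and `0` everywhere else. -/
def Store.init (n : ℕ) : Store where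
  int := Function.update (fun _ => 0) 0 (n : ℤ)
  real := fun _ => 0

/-- With input the dimension `n` and the oracle `x ↦ ‖x‖_K`, the program `c` halts after exactly
`t` steps with output `v`, read at real address `0`. -/
def Outputs {n : ℕ} (c : Cmd) (K : Set (EuclideanSpace ℝ (Fin n))) (v : ℝ) (t : ℕ) : Prop :=
  ∃ τ : Store, Exec K c (Store.init n) τ t ∧ τ.real 0 = v

end EllEstimate

end

noncomputable section

namespace EllEstimate
open ProbabilityTheory ENNReal

/-! Approximation. Round a Gaussian vector to the nearest point of the grid, so that `x = g + y`
with `y` in the cell. By the triangle inequality for the gauge, replacing `‖x‖_K` by `‖g‖_K` costs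
at most `‖y‖_K`. Thus `ellTilde K` differs from the integral of `‖x‖_K γ` over the points rounded
into `D` by at most `∑ ∫_cell ‖y‖_K γ(g + y) dy`. Two facts bound this sum by `11/12 · ℓ(K)/s`.

The first is Poisson summation (`sum_gaussianPDFReal_le`): a shift of the grid only introduces
phases on the dual side, so for every `y` the sum of `γ(g + y)` is at most `(s(1 + 2/(4n+1)))ⁿ ≤
33/20 · sⁿ`. The scale is chosen exactly so that the error per coordinate is `O(1/n)`. Hence `y` is
nearly uniform on the cell, up to a constant factor.

The second is a convex domination (`EConvex.lintegral_pi_unif_le`): the uniform law on `[-9/10,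
9/10]` has smaller means of convex functions than the standard Gaussian, and this passes to products
one coordinate at a time. Applied to the gauge and rescaled to the cell, it bounds the uniform mean
of `‖y‖_K` by `5/9 · ℓ(K)/s`.

The upper bound follows at once. The lower bound also loses the part of `ℓ(K)` on points rounded
outside `D`, which have norm at least `2√n`. There `γ(x) ≤ 4⁻ⁿ γ(x/2)`, so homogeneity of the gauge
makes this part at most `2·2⁻ⁿ ℓ(K)` (`IsSymmConvexBody.tail_le`). If `s > 1` this is at most `1/12
· ℓ(K)/s`; if `s ≤ 1` the lower bound is trivial.

Counting and running time. Each point of `D` has squared norm at most `16n`, hence density at least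
`cⁿ`; comparison with the Poisson bound gives `|D| ≤ (C s)ⁿ`. Membership in `D` is monotone in the
absolute values of the integer coordinates, so a backtracking search trying `0, 1, -1, 2, -2, …` in
each coordinate may stop at the first failure. Every point of `D` accounts for at most `n` visits of
cost `O(n)` (`leads_completions`), weights being products of differences of the normal distribution
function. The factor `n²` is absorbed in the base of the exponential. -/

lemma gaussianPDFReal_std (t : ℝ) :
    gaussianPDFReal 0 1 t = 1 / Real.sqrt (2 * Real.pi) * Real.exp (-(1 / 2) * t ^ 2) := by
  simp only [gaussianPDFReal, NNReal.coe_one, mul_one, sub_zero, one_div]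
  congr 2; ring

/-! ### Uniform versus Gaussian means of convex functions on the line -/

lemma integral_Ioi_id_mul_gaussianPDFReal (a : ℝ) :
    ∫ t in Set.Ioi a, t * gaussianPDFReal 0 1 t = gaussianPDFReal 0 1 a := by
  have hd : ∀ t ∈ Set.Ici a, HasDerivAt (fun t => -gaussianPDFReal 0 1 t)
      (t * gaussianPDFReal 0 1 t) t := by
    intro t _
    simp only [gaussianPDFReal_std]
    have h1 : HasDerivAt (fun t : ℝ => -(1 / 2) * t ^ 2) (-t) t := by
      have := (hasDerivAt_pow 2 t).const_mul (-(1 / 2) : ℝ)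
      exact this.congr_deriv (by norm_num; ring)
    have := (h1.exp.const_mul (1 / Real.sqrt (2 * Real.pi))).neg
    exact this.congr_deriv (by ring)
  have hint : IntegrableOn (fun t => t * gaussianPDFReal 0 1 t) (Set.Ioi a) := by
    refine Integrable.integrableOn ?_
    have h := (integrable_mul_exp_neg_mul_sq (b := 1 / 2) (by norm_num))
    refine (h.const_mul (1 / Real.sqrt (2 * Real.pi))).congr (ae_of_all _ fun t => ?_)
    simp only [gaussianPDFReal_std]
    ring
  have hlim : Filter.Tendsto (fun t => -gaussianPDFReal 0 1 t) Filter.atTop (nhds 0) := by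
    simp only [gaussianPDFReal_std]
    have : Filter.Tendsto (fun t : ℝ => -(1 / 2) * t ^ 2) Filter.atTop Filter.atBot :=
      (Filter.tendsto_pow_atTop two_ne_zero).const_mul_atTop_of_neg (by norm_num)
    simpa using ((Real.tendsto_exp_atBot.comp this).const_mul (1 / Real.sqrt (2 * Real.pi))).neg
  rw [integral_Ioi_of_hasDerivAt_of_tendsto' hd hint hlim]
  ring

/-- This is `φ(a) ≥ a/4` at `a = 9/10`, equivalent to the tail moment `2φ(a)/a` being at least
`1/2`. A larger `a` means a better constant `1/(2a)` later. -/
lemma gaussianPDFReal_nine_tenths : 9 / 40 ≤ gaussianPDFReal 0 1 (9 / 10) := by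
  rw [gaussianPDFReal_std]
  have h1 : Real.sqrt (2 * Real.pi) ≤ 2.51 := by
    rw [Real.sqrt_le_left (by norm_num)]
    have := Real.pi_lt_d2
    norm_num at this ⊢; linarith
  have h2 : (119 / 200 : ℝ) ≤ Real.exp (-(1 / 2) * (9 / 10) ^ 2) := by
    have := Real.add_one_le_exp (-(1 / 2) * (9 / 10) ^ 2 : ℝ)
    norm_num at this ⊢; linarith
  have h3 : 1 / 2.51 ≤ 1 / Real.sqrt (2 * Real.pi) :=
    one_div_le_one_div_of_le (by positivity) h1
  calc (9 / 40 : ℝ) ≤ 1 / 2.51 * (119 / 200) := by norm_num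
    _ ≤ _ := by gcongr

lemma half_le_integral_tail :
    1 / 2 ≤ ∫ t, (Set.Ioi (9 / 10 : ℝ)).indicator (fun t => t / (9 / 10)) |t| ∂gaussianReal 0 1 := by
  rw [integral_gaussianReal_eq_integral_smul one_ne_zero]
  have h : ∀ t : ℝ, gaussianPDFReal 0 1 t • (Set.Ioi (9 / 10 : ℝ)).indicator (fun t => t / (9 / 10)) |t|
      = (fun r => (Set.Ioi (9 / 10 : ℝ)).indicator
          (fun t => 10 / 9 * (t * gaussianPDFReal 0 1 t)) r) |t| := by
    intro t
    have : gaussianPDFReal 0 1 |t| = gaussianPDFReal 0 1 t := by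
      simp [gaussianPDFReal_std]
    by_cases ht : |t| ∈ Set.Ioi (9 / 10 : ℝ)
    · simp only [Set.indicator_of_mem ht, this, smul_eq_mul]; ring
    · simp only [Set.indicator_of_notMem ht, smul_zero]
  simp_rw [h]
  rw [integral_comp_abs, setIntegral_indicator measurableSet_Ioi]
  have : Set.Ioi (0 : ℝ) ∩ Set.Ioi (9 / 10) = Set.Ioi (9 / 10) :=
    Set.inter_eq_right.2 (Set.Ioi_subset_Ioi (by norm_num))
  rw [this, integral_const_mul, integral_Ioi_id_mul_gaussianPDFReal]
  have := gaussianPDFReal_nine_tenths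
  linarith

/-- Convex functions have a smaller mean under the uniform distribution on `[-9/10, 9/10]` than
under the standard Gaussian. -/
lemma integral_uniform_le_integral_gaussianReal {H : ℝ → ℝ} (hH : ConvexOn ℝ Set.univ H)
    (hint : Integrable H (gaussianReal 0 1)) :
    5 / 9 * ∫ t in (-(9 / 10))..(9 / 10), H t ≤ ∫ t, H t ∂gaussianReal 0 1 := by
  set a : ℝ := 9 / 10 with ha
  have ha0 : 0 < a := by norm_num [ha]
  have hcont : Continuous H := by
    rw [← continuousOn_univ]
    exact hH.continuousOn isOpen_univ
  have hii : ∀ x y, IntervalIntegrable H volume x y := fun x y => hcont.intervalIntegrable x y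
  set A := H 0 with hA
  set B := (H a + H (-a)) / 2 with hB
  have hconv : ∀ x y p q : ℝ, 0 ≤ p → 0 ≤ q → p + q = 1 →
      H (p * x + q * y) ≤ p * H x + q * H y := fun x y p q hp hq hpq =>
    hH.2 (Set.mem_univ x) (Set.mem_univ y) hp hq hpq
  have hAB : ∀ t, 2 * A ≤ H t + H (-t) := by
    intro t
    have := hconv t (-t) (1 / 2) (1 / 2) (by norm_num) (by norm_num) (by norm_num)
    rw [show 1 / 2 * t + 1 / 2 * -t = 0 by ring] at this
    linarith
  -- The even part of `H` takes the values `A` at `0` and `B` at `±a`. Outside `[-a, a]` it lies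
  -- above the extended chord, inside it is at least `A`.
  have hlow : ∀ t, A + (B - A) * (Set.Ioi a).indicator (fun t => t / a) |t|
      ≤ (H t + H (-t)) / 2 := by
    intro t
    by_cases ht : |t| ∈ Set.Ioi a
    · rw [Set.indicator_of_mem ht]
      have ht' : a < |t| := ht
      have key : ∀ u, a < u → A + (B - A) * (u / a) ≤ (H u + H (-u)) / 2 := by
        intro u hu
        have hu0 : 0 < u := ha0.trans hu
        have hq : 0 ≤ 1 - a / u := by
          rw [sub_nonneg, div_le_one hu0]; exact hu.le
        have h1 := hconv u 0 (a / u) (1 - a / u) (by positivity) hq (by ring)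
        have h2 := hconv (-u) 0 (a / u) (1 - a / u) (by positivity) hq (by ring)
        rw [show a / u * u + (1 - a / u) * 0 = a by field_simp; ring] at h1
        rw [show a / u * -u + (1 - a / u) * 0 = -a by field_simp; ring] at h2
        have h3 : B ≤ a / u * ((H u + H (-u)) / 2) + (1 - a / u) * A := by
          rw [hB]; linarith
        have h4 : (B - A) * (u / a) ≤ (a / u * ((H u + H (-u)) / 2 - A)) * (u / a) := by
          apply mul_le_mul_of_nonneg_right _ (by positivity)
          linarith
        rw [show (a / u * ((H u + H (-u)) / 2 - A)) * (u / a) = (H u + H (-u)) / 2 - A by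
          field_simp] at h4
        linarith
      rcases abs_choice t with h | h
      · rw [h] at ht' ⊢; exact key t ht'
      · rw [h] at ht' ⊢
        have := key (-t) ht'
        rw [neg_neg] at this; linarith
    · rw [Set.indicator_of_notMem ht]
      have := hAB t
      linarith
  -- On `[0, a]` the even part lies below the same chord, so its uniform mean is at most `(A +
  -- B)/2`.
  have hupp : ∀ t ∈ Set.Icc 0 a, H t + H (-t) ≤ 2 * A + 2 * (B - A) / a * t := by
    intro t ht
    have hq : 0 ≤ 1 - t / a := by
      rw [sub_nonneg, div_le_one ha0]; exact ht.2
    have hp : 0 ≤ t / a := div_nonneg ht.1 ha0.le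
    have h1 := hconv a 0 (t / a) (1 - t / a) hp hq (by ring)
    have h2 := hconv (-a) 0 (t / a) (1 - t / a) hp hq (by ring)
    rw [show t / a * a + (1 - t / a) * 0 = t by field_simp; ring] at h1
    rw [show t / a * -a + (1 - t / a) * 0 = -t by field_simp; ring] at h2
    calc H t + H (-t) ≤ t / a * (H a + H (-a)) + 2 * ((1 - t / a) * A) := by linarith
      _ = _ := by rw [hB]; ring
  have hL : ∫ t in (-a)..a, H t ≤ a * (A + B) := by
    have e1 : ∫ t in (-a)..a, H t = ∫ t in (0)..a, (H t + H (-t)) := by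
      have hneg : IntervalIntegrable (fun t => H (-t)) volume 0 a :=
        (hcont.comp continuous_neg).intervalIntegrable _ _
      rw [intervalIntegral.integral_add (hii _ _) hneg, intervalIntegral.integral_comp_neg,
        neg_zero, ← intervalIntegral.integral_add_adjacent_intervals (hii (-a) 0) (hii 0 a)]
      ring
    rw [e1]
    have e2 : ∫ t in (0)..a, (H t + H (-t)) ≤ ∫ t in (0)..a, (2 * A + 2 * (B - A) / a * t) := by
      refine intervalIntegral.integral_mono_on ha0.le ?_ ?_ hupp
      · exact (hcont.add (hcont.comp continuous_neg)).intervalIntegrable _ _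
      · exact (by fun_prop : Continuous fun t => 2 * A + 2 * (B - A) / a * t).intervalIntegrable _ _
    refine e2.trans (le_of_eq ?_)
    rw [intervalIntegral.integral_add (by simp) ((by fun_prop : Continuous fun t =>
      2 * (B - A) / a * t).intervalIntegrable _ _), intervalIntegral.integral_const_mul (2 * (B - A) / a),
      integral_id, intervalIntegral.integral_const]
    simp only [smul_eq_mul]
    field_simp
    ring
  have hneg : Integrable (fun t => H (-t)) (gaussianReal 0 1) := by
    have hm := gaussianReal_map_neg (μ := 0) (v := 1)
    rw [neg_zero] at hm
    rw [← hm] at hint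
    exact (integrable_map_measure (by fun_prop) (by fun_prop)).1 hint
  have hnegi : ∫ t, H (-t) ∂gaussianReal 0 1 = ∫ t, H t ∂gaussianReal 0 1 := by
    have hm := gaussianReal_map_neg (μ := 0) (v := 1)
    rw [neg_zero] at hm
    conv_rhs => rw [← hm]
    rw [integral_map (by fun_prop) (by fun_prop)]
  have htail : Integrable (fun t : ℝ => (Set.Ioi a).indicator (fun t => t / a) |t|)
      (gaussianReal 0 1) := by
    have hb : Integrable (fun t : ℝ => t / a) (gaussianReal 0 1) :=
      (IsGaussian.integrable_id (μ := gaussianReal 0 1)).div_const a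
    refine hb.mono ?_ (ae_of_all _ fun t => ?_)
    · exact (((measurable_id.div_const a).indicator measurableSet_Ioi).comp
        measurable_abs).aestronglyMeasurable
    · refine (norm_indicator_le_norm_self _ _).trans ?_
      simp
  have hR : A + (B - A) * (1 / 2) ≤ ∫ t, H t ∂gaussianReal 0 1 := by
    have e1 : ∫ t, H t ∂gaussianReal 0 1 = ∫ t, (H t + H (-t)) / 2 ∂gaussianReal 0 1 := by
      rw [integral_div, integral_add hint hneg, hnegi]; ring
    rw [e1]
    have e2 := integral_mono (((integrable_const A).add (htail.const_mul (B - A))))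
      ((hint.add hneg).div_const 2) hlow
    refine le_trans ?_ e2
    rw [Pi.add_def, integral_add (integrable_const A) (htail.const_mul (B - A)),
      integral_const_mul, integral_const]
    have hBA : 0 ≤ B - A := by
      have := hAB a
      rw [hB]; linarith
    have := mul_le_mul_of_nonneg_left half_le_integral_tail hBA
    rw [← ha] at this
    simp only [probReal_univ, one_smul]
    linarith
  calc 5 / 9 * ∫ t in (-a)..a, H t ≤ 5 / 9 * (a * (A + B)) := by gcongr
    _ = A + (B - A) * (1 / 2) := by rw [ha]; ring
    _ ≤ _ := hR

/-! ### Extension to product measures -/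

/-- Convexity of extended nonnegative functions. -/
def EConvex {E : Type*} [AddCommGroup E] [Module ℝ E] (f : E → ℝ≥0∞) : Prop :=
  ∀ x y : E, ∀ p q : ℝ, 0 ≤ p → 0 ≤ q → p + q = 1 →
    f (p • x + q • y) ≤ ENNReal.ofReal p * f x + ENNReal.ofReal q * f y

/-- A finite integral makes `h` finite almost everywhere, hence at some point on each side of `t`;
convexity bounds `h t` by these two values. -/
lemma EConvex.ne_top_of_lintegral_ne_top {h : ℝ → ℝ≥0∞} (hm : Measurable h) (hc : EConvex h)
    (hfin : ∫⁻ t, h t ∂gaussianReal 0 1 ≠ ∞) (t : ℝ) : h t ≠ ∞ := by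
  have hae : ∀ᵐ t, h t < ∞ :=
    (gaussianReal_absolutelyContinuous' 0 one_ne_zero).ae_le (ae_lt_top hm hfin)
  have hex : ∀ x y : ℝ, x < y → ∃ u ∈ Set.Ioo x y, h u < ∞ := by
    intro x y hxy
    by_contra! hno
    have h0 : volume (Set.Ioo x y) = 0 := by
      refine measure_mono_null (fun u hu => ?_) hae
      simpa using hno u hu
    simp [hxy.not_ge] at h0
  obtain ⟨u, hu, hu'⟩ := hex (t - 1) t (by linarith)
  obtain ⟨v, hv, hv'⟩ := hex t (t + 1) (by linarith)
  have huv : 0 < v - u := by linarith [hu.2, hv.1]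
  have := hc u v ((v - t) / (v - u)) ((t - u) / (v - u)) (div_nonneg (by linarith [hv.1]) huv.le)
    (div_nonneg (by linarith [hu.2]) huv.le) (by field_simp; ring)
  rw [show ((v - t) / (v - u)) • u + ((t - u) / (v - u)) • v = t by
    simp only [smul_eq_mul]; field_simp; ring] at this
  refine ne_top_of_le_ne_top ?_ this
  exact ENNReal.add_ne_top.2 ⟨ENNReal.mul_ne_top ENNReal.ofReal_ne_top hu'.ne,
    ENNReal.mul_ne_top ENNReal.ofReal_ne_top hv'.ne⟩

/-- The uniform distribution on `[-9/10, 9/10]`. -/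
def unif : Measure ℝ := ENNReal.ofReal (5 / 9) • volume.restrict (Set.Icc (-(9 / 10)) (9 / 10))

instance : IsFiniteMeasure unif := by
  unfold unif
  exact Measure.smul_finite _ ENNReal.ofReal_ne_top

lemma EConvex.lintegral_unif_le {h : ℝ → ℝ≥0∞} (hm : Measurable h) (hc : EConvex h) :
    ∫⁻ t, h t ∂unif ≤ ∫⁻ t, h t ∂gaussianReal 0 1 := by
  by_cases hfin : ∫⁻ t, h t ∂gaussianReal 0 1 = ∞
  · rw [hfin]; exact le_top
  have htop := hc.ne_top_of_lintegral_ne_top hm hfin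
  set H : ℝ → ℝ := fun t => (h t).toReal with hH
  have hconv : ConvexOn ℝ Set.univ H := by
    refine ⟨convex_univ, fun x _ y _ p q hp hq hpq => ?_⟩
    have := ENNReal.toReal_mono (ENNReal.add_ne_top.2
      ⟨ENNReal.mul_ne_top ENNReal.ofReal_ne_top (htop x),
        ENNReal.mul_ne_top ENNReal.ofReal_ne_top (htop y)⟩) (hc x y p q hp hq hpq)
    rwa [ENNReal.toReal_add (ENNReal.mul_ne_top ENNReal.ofReal_ne_top (htop x))
        (ENNReal.mul_ne_top ENNReal.ofReal_ne_top (htop y)), ENNReal.toReal_mul,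
      ENNReal.toReal_mul, ENNReal.toReal_ofReal hp, ENNReal.toReal_ofReal hq] at this
  have hhH : ∀ t, h t = ENNReal.ofReal (H t) := fun t => (ENNReal.ofReal_toReal (htop t)).symm
  have hint : Integrable H (gaussianReal 0 1) :=
    integrable_toReal_of_lintegral_ne_top hm.aemeasurable hfin
  have hcont : Continuous H := by
    rw [← continuousOn_univ]
    exact hconv.continuousOn isOpen_univ
  have h0 : ∀ t, 0 ≤ H t := fun t => ENNReal.toReal_nonneg
  simp_rw [hhH]
  rw [← ofReal_integral_eq_lintegral_ofReal hint (ae_of_all _ h0), unif, lintegral_smul_measure,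
    ← ofReal_integral_eq_lintegral_ofReal (hcont.continuousOn.integrableOn_Icc) (ae_of_all _ h0),
    smul_eq_mul, ← ENNReal.ofReal_mul (by norm_num)]
  apply ENNReal.ofReal_le_ofReal
  have := integral_uniform_le_integral_gaussianReal hconv hint
  rwa [intervalIntegral.integral_of_le (by norm_num), ← integral_Icc_eq_integral_Ioc] at this

/-- Averaging over some coordinates preserves convexity in the others. Values in `ℝ≥0∞` spare any
check that the marginals are finite. -/
lemma EConvex.lmarginal {ι : Type*} [DecidableEq ι] {f : (ι → ℝ) → ℝ≥0∞} (hm : Measurable f)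
    (hc : EConvex f) (μ : ι → Measure ℝ) [∀ i, SigmaFinite (μ i)] (s : Finset ι) :
    EConvex (∫⋯∫⁻_s, f ∂μ) := by
  intro x y p q hp hq hpq
  have hup : ∀ z : ι → ℝ, Measurable fun w : s → ℝ => f (Function.updateFinset z s w) :=
    fun z => hm.comp measurable_updateFinset
  simp only [MeasureTheory.lmarginal]
  rw [← lintegral_const_mul _ (hup x), ← lintegral_const_mul _ (hup y),
    ← lintegral_add_left ((hup x).const_mul _)]
  refine lintegral_mono fun w => ?_
  refine le_trans (le_of_eq ?_) (hc _ _ p q hp hq hpq)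
  congr 1
  funext i
  simp only [Function.updateFinset, Pi.add_apply, Pi.smul_apply, smul_eq_mul]
  split_ifs with h
  · rw [← add_mul, hpq, one_mul]
  · rfl

lemma EConvex.lmarginal_unif_le {ι : Type*} [DecidableEq ι] {f : (ι → ℝ) → ℝ≥0∞}
    (hm : Measurable f) (hc : EConvex f) (s : Finset ι) (x : ι → ℝ) :
    (∫⋯∫⁻_s, f ∂fun _ => unif) x ≤ (∫⋯∫⁻_s, f ∂fun _ => gaussianReal 0 1) x := by
  induction s using Finset.induction_on generalizing x with
  | empty => simp
  | insert i s hi ih =>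
    -- The coordinates in `s` are exchanged by induction under the integral over coordinate `i`. The
    -- exchange in coordinate `i` itself is the one-dimensional comparison for the marginal, which
    -- is convex.
    rw [lmarginal_insert _ hm hi, lmarginal_insert _ hm hi]
    have hmarg := hc.lmarginal hm (fun _ => unif) s
    refine le_trans ?_ (lintegral_mono fun t => ih _)
    refine EConvex.lintegral_unif_le ?_ ?_
    · exact (hm.lmarginal _).comp (measurable_update x)
    · intro u v p q hp hq hpq
      refine le_trans (le_of_eq ?_) (hmarg _ _ p q hp hq hpq)
      refine congrArg (∫⋯∫⁻_s, f ∂fun _ => unif) (funext fun j => ?_)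
      by_cases hj : j = i
      · subst hj; simp
      · simp [hj, ← add_mul, hpq]

/-- Convex functions on `ℝⁿ` have a smaller mean under the uniform distribution on a cube than
under the standard Gaussian. -/
lemma EConvex.lintegral_pi_unif_le {ι : Type*} [Fintype ι] {f : (ι → ℝ) → ℝ≥0∞}
    (hm : Measurable f) (hc : EConvex f) :
    ∫⁻ x, f x ∂(Measure.pi fun _ => unif) ≤ ∫⁻ x, f x ∂(Measure.pi fun _ => gaussianReal 0 1) := by
  classical
  rw [lintegral_eq_lmarginal_univ 0, lintegral_eq_lmarginal_univ 0]
  exact hc.lmarginal_unif_le hm Finset.univ 0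

/-! ### Gaussian sums over shifted lattices -/

lemma summable_exp_neg_mul_int_sq {A : ℝ} (hA : 0 < A) (c : ℝ) :
    Summable fun k : ℤ => Real.exp (-A * ((k : ℝ) + c) ^ 2) := by
  have h := summable_pow_mul_jacobiTheta₂_term_bound (A * |c| / Real.pi) (T := A / Real.pi)
    (by positivity) 0
  refine Summable.of_nonneg_of_le (fun k => (Real.exp_pos _).le) (fun k => ?_) h
  rw [pow_zero, one_mul, Real.exp_le_exp]
  have h1 : -Real.pi * (A / Real.pi * (k : ℝ) ^ 2 - 2 * (A * |c| / Real.pi) * ((|k| : ℤ) : ℝ))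
      = -A * ((k : ℝ) ^ 2 - 2 * |c| * |(k : ℝ)|) := by
    rw [Int.cast_abs]; field_simp
  rw [h1]
  have h2 : -(|c| * |(k : ℝ)|) ≤ c * k := by rw [← abs_mul]; exact neg_abs_le _
  have h3 : (k : ℝ) ^ 2 - 2 * |c| * |(k : ℝ)| ≤ ((k : ℝ) + c) ^ 2 := by nlinarith [sq_nonneg c]
  nlinarith

/-- Poisson summation bounds the sum of a Gaussian density over a shifted lattice. -/
lemma sum_gaussianPDFReal_le {s : ℝ} (hs : 0 < s) (y : ℝ) (F : Finset ℤ) :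
    ∑ k ∈ F, gaussianPDFReal 0 1 (y + k / s) ≤
      s * ∑' m : ℤ, Real.exp (-(2 * Real.pi ^ 2 * s ^ 2) * (m : ℝ) ^ 2) := by
  have hpi := Real.pi_pos
  set c : ℝ := s * y with hc
  have hterm : ∀ k : ℤ, gaussianPDFReal 0 1 (y + k / s) =
      1 / Real.sqrt (2 * Real.pi) * Real.exp (-(1 / (2 * s ^ 2)) * ((k : ℝ) + c) ^ 2) := by
    intro k
    rw [gaussianPDFReal_std]
    congr 2
    rw [hc]; field_simp; ring
  have hsum := summable_exp_neg_mul_int_sq (A := 1 / (2 * s ^ 2)) (by positivity) c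
  have hsum2 := summable_exp_neg_mul_int_sq (A := 2 * Real.pi ^ 2 * s ^ 2) (by positivity) 0
  simp only [add_zero] at hsum2
  set A : ℝ := 2 * Real.pi * s ^ 2 with hA
  have hA0 : 0 < A := by positivity
  -- With linear coefficient `-ic` the quadratic side is shifted by the real number `c`, while on
  -- the dual side `c` appears only in factors of modulus one. Taking norms removes it.
  have hq := Complex.tsum_exp_neg_quadratic (a := (A : ℂ)) (by simpa using hA0)
    (-(Complex.I * (c : ℂ)))
  have hsq : (1 : ℂ) / (A : ℂ) ^ (1 / 2 : ℂ) = ((1 / Real.sqrt A : ℝ) : ℂ) := by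
    rw [Real.sqrt_eq_rpow, Complex.ofReal_div, Complex.ofReal_cpow hA0.le]
    norm_num
  have hR : ∑' k : ℤ, Complex.exp (-Real.pi / (A : ℂ) * ((k : ℂ) +
      Complex.I * -(Complex.I * (c : ℂ))) ^ 2) =
      ((∑' k : ℤ, Real.exp (-(1 / (2 * s ^ 2)) * ((k : ℝ) + c) ^ 2) : ℝ) : ℂ) := by
    rw [Complex.ofReal_tsum]
    refine tsum_congr fun k => ?_
    rw [Complex.ofReal_exp]
    congr 1
    have hI : Complex.I * -(Complex.I * (c : ℂ)) = c := by
      rw [mul_neg, ← mul_assoc, Complex.I_mul_I]; ring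
    have hco : -Real.pi / A = -(1 / (2 * s ^ 2)) := by rw [hA]; field_simp
    rw [hI, ← hco]
    push_cast
    ring
  rw [hR, hsq, ← Complex.ofReal_mul] at hq
  set S := ∑' k : ℤ, Real.exp (-(1 / (2 * s ^ 2)) * ((k : ℝ) + c) ^ 2) with hS
  have hnormt : ∀ m : ℤ, ‖Complex.exp (-Real.pi * (A : ℂ) * (m : ℂ) ^ 2 +
      2 * Real.pi * -(Complex.I * (c : ℂ)) * m)‖ =
      Real.exp (-(2 * Real.pi ^ 2 * s ^ 2) * (m : ℝ) ^ 2) := by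
    intro m
    rw [Complex.norm_exp]
    congr 1
    have : (-Real.pi * (A : ℂ) * (m : ℂ) ^ 2 + 2 * Real.pi * -(Complex.I * (c : ℂ)) * m) =
        ((-(2 * Real.pi ^ 2 * s ^ 2) * (m : ℝ) ^ 2 : ℝ) : ℂ) +
          ((-(2 * Real.pi * c * m) : ℝ) : ℂ) * Complex.I := by
      rw [hA]; push_cast; ring
    rw [this, Complex.add_re, Complex.re_ofReal_mul, Complex.I_re, mul_zero, add_zero,
      Complex.ofReal_re]
  have hle : 1 / Real.sqrt A * S ≤ ∑' m : ℤ, Real.exp (-(2 * Real.pi ^ 2 * s ^ 2) * (m : ℝ) ^ 2) := by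
    calc 1 / Real.sqrt A * S ≤ ‖((1 / Real.sqrt A * S : ℝ) : ℂ)‖ := by
          rw [Complex.norm_real]; exact le_abs_self _
      _ ≤ _ := by
          rw [← hq]
          refine (norm_tsum_le_tsum_norm ?_).trans (le_of_eq (tsum_congr hnormt))
          exact hsum2.congr fun m => (hnormt m).symm
  have hsA : Real.sqrt A = Real.sqrt (2 * Real.pi) * s := by
    rw [hA, Real.sqrt_mul (by positivity), Real.sqrt_sq hs.le]
  calc ∑ k ∈ F, gaussianPDFReal 0 1 (y + k / s)
      = 1 / Real.sqrt (2 * Real.pi) *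
          ∑ k ∈ F, Real.exp (-(1 / (2 * s ^ 2)) * ((k : ℝ) + c) ^ 2) := by
        rw [Finset.mul_sum]; exact Finset.sum_congr rfl fun k _ => hterm k
    _ ≤ 1 / Real.sqrt (2 * Real.pi) * S := by
        gcongr
        exact hsum.sum_le_tsum F fun k _ => (Real.exp_pos _).le
    _ = s * (1 / Real.sqrt A * S) := by rw [hsA]; field_simp
    _ ≤ _ := by gcongr

/-- Since `m² ≥ |m|`, each half of the sum is dominated by a geometric series of ratio `exp(-A)`. -/
lemma tsum_int_exp_neg_sq_le {A : ℝ} (hA : 0 < A) :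
    ∑' m : ℤ, Real.exp (-A * (m : ℝ) ^ 2) ≤ 1 + 2 * (Real.exp (-A) / (1 - Real.exp (-A))) := by
  set q := Real.exp (-A) with hq
  have hq0 : 0 < q := Real.exp_pos _
  have hq1 : q < 1 := by rw [hq, Real.exp_lt_one_iff]; linarith
  have hsum := summable_exp_neg_mul_int_sq hA 0
  simp only [add_zero] at hsum
  have hb : ∀ n : ℕ, Real.exp (-A * ((n : ℝ) + 1) ^ 2) ≤ q * q ^ n := by
    intro n
    rw [hq, ← Real.exp_nat_mul, ← Real.exp_add, Real.exp_le_exp]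
    have : (0 : ℝ) ≤ n := n.cast_nonneg
    nlinarith [mul_nonneg hA.le (mul_nonneg this (by linarith : (0:ℝ) ≤ n + 1))]
  have hg : HasSum (fun n : ℕ => q * q ^ n) (q * (1 - q)⁻¹) :=
    (hasSum_geometric_of_lt_one hq0.le hq1).mul_left q
  have hs1 : Summable fun n : ℕ => Real.exp (-A * ((n : ℝ) + 1) ^ 2) :=
    Summable.of_nonneg_of_le (fun _ => (Real.exp_pos _).le) hb hg.summable
  have hle := (hs1.tsum_le_tsum hb hg.summable).trans_eq hg.tsum_eq
  have hf1 : HasSum (fun n : ℕ => Real.exp (-A * (((n + 1 : ℕ) : ℤ) : ℝ) ^ 2))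
      (∑' n : ℕ, Real.exp (-A * ((n : ℝ) + 1) ^ 2)) := by
    simpa using hs1.hasSum
  have h0 : HasSum (fun n : ℕ => Real.exp (-A * ((n : ℤ) : ℝ) ^ 2))
      (1 + ∑' n : ℕ, Real.exp (-A * ((n : ℝ) + 1) ^ 2)) := by
    have := (hasSum_nat_add_iff (f := fun n : ℕ => Real.exp (-A * ((n : ℤ) : ℝ) ^ 2)) 1).1 hf1
    simpa [add_comm] using this
  have hneg : HasSum (fun n : ℕ => Real.exp (-A * ((-((n : ℤ) + 1) : ℤ) : ℝ) ^ 2))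
      (∑' n : ℕ, Real.exp (-A * ((n : ℝ) + 1) ^ 2)) := by
    convert hs1.hasSum using 3 with n
    push_cast; ring
  rw [(HasSum.of_nat_of_neg_add_one (f := fun m : ℤ => Real.exp (-A * (m : ℝ) ^ 2)) h0 hneg).tsum_eq]
  rw [div_eq_mul_inv]
  linarith

/-! ### The size of the scale -/

variable {n : ℕ}

lemma log_arg_pos (hn : 1 ≤ n) : 0 < Real.log (2 * (2 * (n : ℝ) + 1)) := by
  have : (1 : ℝ) ≤ n := by exact_mod_cast hn
  exact Real.log_pos (by linarith)

lemma scale_pos (hn : 1 ≤ n) : 0 < scale n := by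
  have := log_arg_pos hn
  unfold scale; positivity

/-- The identity behind the choice of `s`: the dual ratio `q = exp(-2π²s²)` becomes `1/(2(2n+1))`,
so that `2q/(1-q) = 2/(4n+1)`. -/
lemma scale_sq (hn : 1 ≤ n) :
    2 * Real.pi ^ 2 * scale n ^ 2 = Real.log (2 * (2 * (n : ℝ) + 1)) := by
  have h := log_arg_pos hn
  rw [scale, mul_pow, div_pow, Real.sq_sqrt (by positivity), Real.sq_sqrt (by positivity)]
  field_simp

/-- The sum of the Gaussian density over any part of a shift of `(1/s)ℤ` is at most
`s (1 + 2 / (4n + 1))`. -/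
lemma sum_gaussianPDFReal_grid_le (hn : 1 ≤ n) (y : ℝ) (F : Finset ℤ) :
    ∑ k ∈ F, gaussianPDFReal 0 1 (y + k / scale n) ≤
      scale n * (1 + 2 / (4 * n + 1)) := by
  have hs := scale_pos hn
  have hn' : (1 : ℝ) ≤ n := by exact_mod_cast hn
  refine (sum_gaussianPDFReal_le hs y F).trans ?_
  rw [scale_sq hn]
  gcongr
  refine (tsum_int_exp_neg_sq_le (log_arg_pos hn)).trans (le_of_eq ?_)
  rw [Real.exp_neg, Real.exp_log (by linarith)]
  have : (4 : ℝ) * n + 1 ≠ 0 := by linarith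
  have h3 : 2 * (2 * (n : ℝ) + 1) - 1 = 4 * n + 1 := by ring
  have h2 : 1 - (2 * (2 * (n : ℝ) + 1))⁻¹ = (4 * n + 1) / (2 * (2 * (n : ℝ) + 1)) := by
    rw [← h3]; field_simp
  rw [h2]; field_simp

lemma quarter_le_scale (hn : 1 ≤ n) : 1 / 4 ≤ scale n := by
  have h := scale_sq hn
  have hn' : (1 : ℝ) ≤ n := by exact_mod_cast hn
  have h4 : Real.log 4 ≤ Real.log (2 * (2 * (n : ℝ) + 1)) :=
    Real.log_le_log (by norm_num) (by linarith)
  have h5 : Real.log 4 = 2 * Real.log 2 := by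
    rw [show (4 : ℝ) = 2 ^ 2 by norm_num, Real.log_pow]; norm_num
  have h6 := Real.log_two_gt_d9
  have hp := Real.pi_lt_d2
  have hp0 := Real.pi_pos
  by_contra! hlt
  have hs := scale_pos hn
  have h7 : scale n ^ 2 < 1 / 16 := by nlinarith
  have h8 : Real.pi ^ 2 < 10 := by nlinarith
  nlinarith [sq_nonneg (scale n), sq_nonneg Real.pi]

/-- For `n ≥ 2` one has `2(2n+1) ≤ n⁴`, and the resulting factor `4` is less than `2π²`. -/
lemma scale_le_sqrt_log (hn : 2 ≤ n) : scale n ≤ Real.sqrt (Real.log n) := by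
  have hn' : (2 : ℝ) ≤ n := by exact_mod_cast hn
  apply Real.le_sqrt_of_sq_le
  have h := scale_sq (by omega : 1 ≤ n)
  have h4 : Real.log (2 * (2 * (n : ℝ) + 1)) ≤ 4 * Real.log n := by
    rw [show 4 * Real.log (n : ℝ) = Real.log ((n : ℝ) ^ 4) by rw [Real.log_pow]; norm_num]
    refine Real.log_le_log (by linarith) ?_
    have h2 : (8 : ℝ) ≤ n ^ 3 := by
      calc (8 : ℝ) = 2 ^ 3 := by norm_num
        _ ≤ n ^ 3 := by gcongr
    nlinarith
  have hp := Real.pi_gt_three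
  have : (9 : ℝ) ≤ Real.pi ^ 2 := by nlinarith
  have hl : 0 ≤ Real.log (n : ℝ) := Real.log_nonneg (by linarith)
  nlinarith [sq_nonneg (scale n)]

/-! ### The gauge and the Gaussian density -/

section gauge

variable {K : Set (EuclideanSpace ℝ (Fin n))}

lemma IsSymmConvexBody.mem_nhds_zero (hK : IsSymmConvexBody K) : K ∈ nhds 0 := by
  obtain ⟨x, hx⟩ := hK.interior_nonempty
  have hx' : -x ∈ K := hK.symm x (interior_subset hx)
  have h := hK.convex.openSegment_interior_self_subset_interior hx hx'
  have h0 : (0 : EuclideanSpace ℝ (Fin n)) ∈ openSegment ℝ x (-x) :=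
    ⟨1 / 2, 1 / 2, by norm_num, by norm_num, by norm_num, by simp⟩
  exact mem_interior_iff_mem_nhds.1 (h h0)

lemma IsSymmConvexBody.absorbent (hK : IsSymmConvexBody K) : Absorbent ℝ K :=
  absorbent_nhds_zero hK.mem_nhds_zero

lemma IsSymmConvexBody.continuous_gauge (hK : IsSymmConvexBody K) : Continuous (gauge K) :=
  _root_.continuous_gauge hK.convex hK.mem_nhds_zero

lemma IsSymmConvexBody.exists_gauge_le (hK : IsSymmConvexBody K) :
    ∃ c : ℝ, 0 ≤ c ∧ ∀ x, gauge K x ≤ c * ‖x‖ := by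
  obtain ⟨r, hr, hrK⟩ := Metric.mem_nhds_iff.1 hK.mem_nhds_zero
  refine ⟨1 / r, by positivity, fun x => ?_⟩
  have := mul_gauge_le_norm (x := x) hrK
  rw [one_div, ← div_eq_inv_mul, le_div_iff₀ hr]; linarith

lemma IsSymmConvexBody.gauge_le_add_sub (hK : IsSymmConvexBody K)
    (x y : EuclideanSpace ℝ (Fin n)) : gauge K x ≤ gauge K (x + y) + gauge K y := by
  have h := gauge_add_le hK.convex hK.absorbent (x + y) (-y)
  rwa [add_neg_cancel_right, gauge_neg hK.symm] at h

lemma IsSymmConvexBody.gauge_add_le (hK : IsSymmConvexBody K)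
    (x y : EuclideanSpace ℝ (Fin n)) : gauge K (x + y) ≤ gauge K x + gauge K y :=
  _root_.gauge_add_le hK.convex hK.absorbent x y

lemma gauge_smul_nonneg {r : ℝ} (hr : 0 ≤ r) (x : EuclideanSpace ℝ (Fin n)) :
    gauge K (r • x) = r * gauge K x := by
  rw [gauge_smul_of_nonneg hr, smul_eq_mul]

lemma gaussDensity_pos (x : EuclideanSpace ℝ (Fin n)) : 0 < gaussDensity x := by
  unfold gaussDensity; positivity

lemma continuous_gaussDensity : Continuous (gaussDensity (n := n)) := by
  unfold gaussDensity; fun_prop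

lemma gaussDensity_eq_prod (x : EuclideanSpace ℝ (Fin n)) :
    gaussDensity x = ∏ i, gaussianPDFReal 0 1 (x i) := by
  simp_rw [gaussianPDFReal_std]
  rw [Finset.prod_mul_distrib, ← Real.exp_sum, ← Finset.mul_sum, gaussDensity,
    EuclideanSpace.real_norm_sq_eq]
  simp

/-- Half of the exponent absorbs the factor `‖x‖`; the other half is an integrable Gaussian. -/
lemma integrable_norm_mul_exp_neg_sq {b : ℝ} (hb : 0 < b) :
    Integrable fun x : EuclideanSpace ℝ (Fin n) => ‖x‖ * Real.exp (-b * ‖x‖ ^ 2) := by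
  have h := GaussianFourier.integrable_cexp_neg_mul_sq_norm_add (b := ((b / 2 : ℝ) : ℂ))
    (by simpa using hb) 0 (0 : EuclideanSpace ℝ (Fin n))
  have h2 := (h.norm).const_mul (1 + 1 / b)
  refine h2.mono (by fun_prop) (ae_of_all _ fun x => ?_)
  have e : ‖Complex.exp (-((b / 2 : ℝ) : ℂ) * (‖x‖ : ℂ) ^ 2 + 0 * (inner ℝ 0 x : ℂ))‖
      = Real.exp (-(b / 2) * ‖x‖ ^ 2) := by
    rw [Complex.norm_exp, zero_mul, add_zero]
    congr 1
    rw [show -((b / 2 : ℝ) : ℂ) * (‖x‖ : ℂ) ^ 2 = ((-(b / 2) * ‖x‖ ^ 2 : ℝ) : ℂ) by push_cast; ring,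
      Complex.ofReal_re]
  rw [e, norm_mul, norm_norm, Real.norm_eq_abs, Real.abs_exp, norm_mul, Real.norm_eq_abs,
    Real.norm_eq_abs, Real.abs_exp, abs_of_pos (by positivity)]
  have h3 : ‖x‖ ≤ (1 + 1 / b) * Real.exp (b / 2 * ‖x‖ ^ 2) := by
    have h4 := Real.add_one_le_exp (b / 2 * ‖x‖ ^ 2)
    calc ‖x‖ ≤ (1 + 1 / b) * (b / 2 * ‖x‖ ^ 2 + 1) := by
          have : (1 + 1 / b) * (b / 2 * ‖x‖ ^ 2 + 1) =
            ‖x‖ ^ 2 / 2 + 1 + (b / 2 * ‖x‖ ^ 2 + 1 / b) := by field_simp; ring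
          rw [this]
          have : 0 ≤ b / 2 * ‖x‖ ^ 2 + 1 / b := by positivity
          nlinarith [sq_nonneg (‖x‖ - 1)]
      _ ≤ _ := by gcongr
  calc ‖x‖ * Real.exp (-b * ‖x‖ ^ 2)
      ≤ ((1 + 1 / b) * Real.exp (b / 2 * ‖x‖ ^ 2)) * Real.exp (-b * ‖x‖ ^ 2) := by gcongr
    _ = (1 + 1 / b) * Real.exp (-(b / 2) * ‖x‖ ^ 2) := by
      rw [mul_assoc, ← Real.exp_add]; congr 2; ring

lemma IsSymmConvexBody.integrable_gauge_mul_exp (hK : IsSymmConvexBody K) {b : ℝ} (hb : 0 < b) :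
    Integrable fun x => gauge K x * Real.exp (-b * ‖x‖ ^ 2) := by
  obtain ⟨c, hc, hle⟩ := hK.exists_gauge_le
  refine ((integrable_norm_mul_exp_neg_sq (n := n) hb).const_mul c).mono ?_ (ae_of_all _ fun x => ?_)
  · exact (hK.continuous_gauge.mul (by fun_prop)).aestronglyMeasurable
  · rw [norm_mul, norm_mul, norm_mul, norm_norm, Real.norm_of_nonneg (gauge_nonneg x),
      Real.norm_of_nonneg hc, ← mul_assoc]
    gcongr
    exact hle x

lemma IsSymmConvexBody.integrable_gauge_mul_gaussDensity (hK : IsSymmConvexBody K) :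
    Integrable fun x => gauge K x * gaussDensity x := by
  refine ((hK.integrable_gauge_mul_exp (b := 1 / 2) (by norm_num)).const_mul
    ((1 / Real.sqrt (2 * Real.pi)) ^ n)).congr (ae_of_all _ fun x => ?_)
  simp only [gaussDensity]; ring

lemma ell_nonneg (K : Set (EuclideanSpace ℝ (Fin n))) : 0 ≤ ell K :=
  integral_nonneg fun x => mul_nonneg (gauge_nonneg x) (gaussDensity_pos x).le

end gauge

/-! ### Coordinates of the cell and the grid; the weights -/

lemma mem_cell (hn : 1 ≤ n) {y : EuclideanSpace ℝ (Fin n)} :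
    y ∈ cell n ↔ ∀ i, y i ∈ Set.Icc (-(1 / (2 * scale n))) (1 / (2 * scale n)) := by
  have hs := scale_pos hn
  have ha : 0 < 1 / (2 * scale n) := by positivity
  rw [cell, Set.mem_smul_set_iff_inv_smul_mem₀ ha.ne']
  simp only [Set.mem_ofPred_eq, PiLp.smul_apply, smul_eq_mul, Set.mem_Icc]
  refine forall_congr' fun i => ?_
  rw [inv_mul_le_one₀ ha, le_inv_mul_iff₀ ha]
  simp

lemma mem_grid (hn : 1 ≤ n) {x : EuclideanSpace ℝ (Fin n)} :
    x ∈ grid n ↔ ∃ k : Fin n → ℤ, ∀ i, x i = k i / scale n := by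
  have hs := scale_pos hn
  have ha : 0 < 1 / scale n := by positivity
  rw [grid, Set.mem_smul_set_iff_inv_smul_mem₀ ha.ne']
  simp only [Set.mem_ofPred_eq, PiLp.smul_apply, smul_eq_mul]
  rw [Classical.skolem]
  refine exists_congr fun k => forall_congr' fun i => ?_
  rw [one_div, inv_inv, eq_div_iff hs.ne', mul_comm]

lemma cell_eq_preimage (hn : 1 ≤ n) : (WithLp.toLp 2) ⁻¹' cell n =
    Set.univ.pi fun _ : Fin n => Set.Icc (-(1 / (2 * scale n))) (1 / (2 * scale n)) := by
  ext y
  simp only [Set.mem_preimage, mem_cell hn, Set.mem_univ_pi]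

lemma isBounded_cell (hn : 1 ≤ n) : Bornology.IsBounded (cell n) := by
  have hs := scale_pos hn
  rw [isBounded_iff_forall_norm_le]
  refine ⟨Real.sqrt (∑ i : Fin n, (1 / (2 * scale n)) ^ 2), fun y hy => ?_⟩
  rw [EuclideanSpace.norm_eq]
  gcongr with i
  have := (mem_cell hn).1 hy i
  rw [Real.norm_eq_abs]
  exact abs_le.2 this

lemma integrableOn_cell (hn : 1 ≤ n) {f : EuclideanSpace ℝ (Fin n) → ℝ}
    (hf : Continuous f) : IntegrableOn f (cell n) :=
  (hf.continuousOn.integrableOn_compact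
    (isBounded_cell hn).isCompact_closure).mono_set subset_closure

lemma setIntegral_gaussianPDFReal (x a : ℝ) (ha : 0 ≤ a) :
    ∫ y in Set.Icc (-a) a, gaussianPDFReal 0 1 (x + y) =
      cdf (gaussianReal 0 1) (x + a) - cdf (gaussianReal 0 1) (x - a) := by
  have hint := integrable_gaussianPDFReal 0 1
  have hc : ∀ t, cdf (gaussianReal 0 1) t = ∫ y in Set.Iic t, gaussianPDFReal 0 1 y := by
    intro t
    rw [cdf_eq_real, measureReal_def, gaussianReal_apply_eq_integral _ one_ne_zero,
      ENNReal.toReal_ofReal (integral_nonneg fun _ => gaussianPDFReal_nonneg _ _ _)]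
  rw [integral_Icc_eq_integral_Ioc, ← intervalIntegral.integral_of_le (by linarith),
    intervalIntegral.integral_comp_add_left (fun y => gaussianPDFReal 0 1 y) x, ← sub_eq_add_neg,
    hc, hc, intervalIntegral.integral_Iic_sub_Iic hint.integrableOn hint.integrableOn]

/-- The weights are products of differences of values of the normal distribution function. -/
lemma weight_eq_prod (hn : 1 ≤ n) (x : EuclideanSpace ℝ (Fin n)) :
    weight x = ∏ i, (cdf (gaussianReal 0 1) (x i + 1 / (2 * scale n)) -
      cdf (gaussianReal 0 1) (x i - 1 / (2 * scale n))) := by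
  have hs := scale_pos hn
  rw [weight, ← (PiLp.volume_preserving_toLp (Fin n)).setIntegral_preimage_emb
    (MeasurableEquiv.toLp 2 (Fin n → ℝ)).measurableEmbedding, cell_eq_preimage hn, volume_pi,
    Measure.restrict_pi_pi]
  simp_rw [gaussDensity_eq_prod, PiLp.add_apply]
  rw [integral_fintype_prod_eq_prod (f := fun i t => gaussianPDFReal 0 1 (x i + t))]
  exact Finset.prod_congr rfl fun i _ => setIntegral_gaussianPDFReal _ _ (by positivity)

lemma weight_nonneg (x : EuclideanSpace ℝ (Fin n)) : 0 ≤ weight x :=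
  integral_nonneg fun _ => (gaussDensity_pos _).le

/-! ### The mean gauge over a cube -/

section comparison

variable {K : Set (EuclideanSpace ℝ (Fin n))}

lemma pi_unif_eq : (Measure.pi fun _ : Fin n => unif) = ENNReal.ofReal (5 / 9) ^ n •
    (volume : Measure (Fin n → ℝ)).restrict (Set.univ.pi fun _ => Set.Icc (-(9 / 10)) (9 / 10)) := by
  rw [volume_pi, Measure.restrict_pi_pi]
  refine (Measure.pi_eq fun s _ => ?_)
  rw [Measure.smul_apply, Measure.pi_pi, smul_eq_mul]
  simp [unif, Finset.prod_mul_distrib]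

lemma pi_gaussianReal_eq : (Measure.pi fun _ : Fin n => gaussianReal 0 1) =
    (volume : Measure (Fin n → ℝ)).withDensity
      fun x => ENNReal.ofReal (gaussDensity (WithLp.toLp 2 x)) := by
  refine (Measure.pi_eq fun s hs => ?_)
  have hint : ∀ i, IntegrableOn (gaussianPDFReal 0 1) (s i) := fun i =>
    (integrable_gaussianPDFReal 0 1).integrableOn
  rw [withDensity_apply _ (MeasurableSet.univ_pi hs), volume_pi, Measure.restrict_pi_pi]
  simp_rw [gaussDensity_eq_prod]
  rw [← ofReal_integral_eq_lintegral_ofReal]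
  · rw [integral_fintype_prod_eq_prod (f := fun i t => gaussianPDFReal 0 1 t),
      ENNReal.ofReal_prod_of_nonneg fun i _ => integral_nonneg fun _ => gaussianPDFReal_nonneg _ _ _]
    exact Finset.prod_congr rfl fun i _ => (gaussianReal_apply_eq_integral 0 one_ne_zero _).symm
  · exact Integrable.fintype_prod fun i => hint i
  · exact ae_of_all _ fun x => Finset.prod_nonneg fun i _ => gaussianPDFReal_nonneg _ _ _

lemma IsSymmConvexBody.eConvex_gauge (hK : IsSymmConvexBody K) :
    EConvex fun w : Fin n → ℝ => ENNReal.ofReal (gauge K (WithLp.toLp 2 w)) := by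
  intro x y p q hp hq _
  beta_reduce
  rw [← ENNReal.ofReal_mul hp, ← ENNReal.ofReal_mul hq,
    ← ENNReal.ofReal_add (mul_nonneg hp (gauge_nonneg _)) (mul_nonneg hq (gauge_nonneg _)),
    WithLp.toLp_add, WithLp.toLp_smul, WithLp.toLp_smul, ← gauge_smul_nonneg hp,
    ← gauge_smul_nonneg hq]
  exact ENNReal.ofReal_le_ofReal (hK.gauge_add_le _ _)

/-- The cube `[-9/10, 9/10]ⁿ`. -/
def cube (n : ℕ) : Set (EuclideanSpace ℝ (Fin n)) :=
  {y | ∀ i, y i ∈ Set.Icc (-(9 / 10) : ℝ) (9 / 10)}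

lemma IsSymmConvexBody.setIntegral_cube_gauge_le (hK : IsSymmConvexBody K) :
    (5 / 9) ^ n * ∫ y in cube n, gauge K y ≤ ell K := by
  have hm : Measurable fun w : Fin n → ℝ => ENNReal.ofReal (gauge K (WithLp.toLp 2 w)) :=
    (hK.continuous_gauge.measurable.comp (by fun_prop)).ennreal_ofReal
  have h := hK.eConvex_gauge.lintegral_pi_unif_le hm
  have hmd : Measurable fun x : Fin n → ℝ => ENNReal.ofReal (gaussDensity (WithLp.toLp 2 x)) :=
    (continuous_gaussDensity.measurable.comp (by fun_prop)).ennreal_ofReal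
  rw [pi_unif_eq, pi_gaussianReal_eq, lintegral_smul_measure,
    lintegral_withDensity_eq_lintegral_mul _ hmd hm] at h
  have hpre : (WithLp.toLp 2) ⁻¹' cube n =
      Set.univ.pi fun _ : Fin n => Set.Icc (-(9 / 10) : ℝ) (9 / 10) := by
    ext y; simp only [cube, Set.mem_preimage, Set.mem_ofPred_eq, Set.mem_univ_pi]
  have hmp := PiLp.volume_preserving_toLp (Fin n)
  have hemb := (MeasurableEquiv.toLp 2 (Fin n → ℝ)).measurableEmbedding
  have hcomp : IsCompact (Set.univ.pi fun _ : Fin n => Set.Icc (-(9 / 10) : ℝ) (9 / 10)) :=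
    isCompact_univ_pi fun _ => isCompact_Icc
  have hl : ∫⁻ w in Set.univ.pi fun _ : Fin n => Set.Icc (-(9 / 10) : ℝ) (9 / 10),
      ENNReal.ofReal (gauge K (WithLp.toLp 2 w)) =
      ENNReal.ofReal (∫ y in cube n, gauge K y) := by
    rw [← hmp.setIntegral_preimage_emb hemb, hpre, ofReal_integral_eq_lintegral_ofReal]
    · exact (hK.continuous_gauge.comp (by fun_prop)).continuousOn.integrableOn_compact hcomp
    · exact ae_of_all _ fun _ => gauge_nonneg _
  have hr : ∫⁻ w : Fin n → ℝ, ((fun x : Fin n → ℝ => ENNReal.ofReal (gaussDensity (WithLp.toLp 2 x)))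
      * fun w : Fin n → ℝ => ENNReal.ofReal (gauge K (WithLp.toLp 2 w))) w =
      ENNReal.ofReal (ell K) := by
    rw [ell, ← hmp.integral_comp hemb, ofReal_integral_eq_lintegral_ofReal]
    · refine lintegral_congr fun w => ?_
      rw [Pi.mul_apply, mul_comm, ENNReal.ofReal_mul (gauge_nonneg _)]
    · exact (hmp.integrable_comp_emb hemb).2 hK.integrable_gauge_mul_gaussDensity
    · exact ae_of_all _ fun _ => mul_nonneg (gauge_nonneg _) (gaussDensity_pos _).le
  rw [hl, hr, ← ENNReal.ofReal_pow (by norm_num), smul_eq_mul,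
    ← ENNReal.ofReal_mul (by positivity), ENNReal.ofReal_le_ofReal_iff (ell_nonneg K)] at h
  exact h

/-- The mean norm of a uniform point of the cell is at most `ℓ(K) / (1.8 s)`. -/
lemma IsSymmConvexBody.setIntegral_cell_gauge_le (hn : 1 ≤ n) (hK : IsSymmConvexBody K) :
    scale n ^ n * ∫ y in cell n, gauge K y ≤ 5 / 9 / scale n * ell K := by
  have hs := scale_pos hn
  -- The dilation factor from `cube n` to the cell: `R · 9/10 = 1/(2s)`.
  set R : ℝ := 5 / 9 / scale n with hR
  have hR0 : 0 < R := by positivity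
  have hcell : cell n = R • cube n := by
    ext y
    rw [mem_cell hn, Set.mem_smul_set_iff_inv_smul_mem₀ hR0.ne']
    simp only [cube, Set.mem_ofPred_eq, PiLp.smul_apply, smul_eq_mul, Set.mem_Icc]
    refine forall_congr' fun i => ?_
    rw [inv_mul_le_iff₀ hR0, le_inv_mul_iff₀ hR0,
      show 1 / (2 * scale n) = R * (9 / 10) by rw [hR]; field_simp; norm_num, mul_neg]
  have h := Measure.setIntegral_comp_smul_of_pos volume (gauge K) (cube n) hR0
  simp only [gauge_smul_nonneg hR0.le, finrank_euclideanSpace, Fintype.card_fin, smul_eq_mul] at h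
  rw [integral_const_mul, ← hcell] at h
  have h2 : ∫ y in cell n, gauge K y = R ^ n * (R * ∫ y in cube n, gauge K y) := by
    rw [h]; field_simp
  calc scale n ^ n * ∫ y in cell n, gauge K y
      = R * ((5 / 9) ^ n * ∫ y in cube n, gauge K y) := by
        rw [h2, hR, div_pow]; field_simp
    _ ≤ R * ell K := by
        gcongr; exact hK.setIntegral_cube_gauge_le

end comparison

/-! ### Sample points as integer vectors -/

/-- The grid point with integer coordinates `k`. -/
def gridPoint (k : Fin n → ℤ) : EuclideanSpace ℝ (Fin n) :=
  WithLp.toLp 2 fun i => (k i : ℝ) / scale n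

@[simp] lemma gridPoint_apply (k : Fin n → ℤ) (i : Fin n) : gridPoint k i = k i / scale n := rfl

/-- The distance of the coordinate `k / s` to the interval `[-1/(2s), 1/(2s)]`. -/
def excess (n : ℕ) (k : ℤ) : ℝ := max (|(k : ℝ) / scale n| - 1 / (2 * scale n)) 0

lemma excess_nonneg (n : ℕ) (k : ℤ) : 0 ≤ excess n k := le_max_right _ _

lemma excess_mono (hn : 1 ≤ n) {k l : ℤ} (h : |k| ≤ |l|) : excess n k ≤ excess n l := by
  have hs := scale_pos hn
  have h' : |(k : ℝ)| ≤ |(l : ℝ)| := by exact_mod_cast h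
  unfold excess
  rw [abs_div, abs_div]
  gcongr

lemma excess_zero (hn : 1 ≤ n) : excess n 0 = 0 := by
  have hs := scale_pos hn
  simp [excess, hs.le]

/-- The integer vectors which index the sample points. -/
def sampleIndices (n : ℕ) : Set (Fin n → ℤ) := {k | ∑ i, excess n (k i) ^ 2 ≤ 4 * n}

lemma gridPoint_injective (hn : 1 ≤ n) : Function.Injective (gridPoint (n := n)) := by
  intro k l h
  have hs := scale_pos hn
  funext i
  have := congrArg (fun x : EuclideanSpace ℝ (Fin n) => x i) h
  simp only [gridPoint_apply, div_left_inj' hs.ne'] at this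
  exact_mod_cast this

/-- The squared distance to a cube is the sum of the squared coordinate distances to its sides. This
turns membership in the Minkowski sum into a test that the program can evaluate. -/
lemma samplePoints_eq_image (hn : 1 ≤ n) : samplePoints n = gridPoint '' sampleIndices n := by
  have hs := scale_pos hn
  have ha : 0 < 1 / (2 * scale n) := by positivity
  have hsq : (2 * Real.sqrt n) ^ 2 = 4 * n := by
    rw [mul_pow, Real.sq_sqrt n.cast_nonneg]; norm_num
  ext x
  constructor
  · rintro ⟨hg, hx⟩
    obtain ⟨k, hk⟩ := (mem_grid hn).1 hg
    obtain ⟨c, hc, z, hz, rfl⟩ := Set.mem_add.1 hx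
    refine ⟨k, ?_, by ext i; rw [gridPoint_apply, hk]⟩
    rw [mem_closedBall_zero_iff] at hz
    have hz2 : ‖z‖ ^ 2 ≤ 4 * n := by rw [← hsq]; gcongr
    rw [EuclideanSpace.real_norm_sq_eq] at hz2
    refine le_trans (Finset.sum_le_sum fun i _ => ?_) hz2
    rw [← sq_abs (z i)]
    have hci := (mem_cell hn).1 hc i
    have hki := hk i
    rw [PiLp.add_apply] at hki
    gcongr
    · exact excess_nonneg _ _
    · refine max_le ?_ (abs_nonneg _)
      rw [← hki]
      have h1 := abs_add_le (c i) (z i)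
      have h2 := abs_le.2 hci
      linarith
  · rintro ⟨k, hk, rfl⟩
    refine ⟨(mem_grid hn).2 ⟨k, fun i => rfl⟩, ?_⟩
    set a := 1 / (2 * scale n) with ha'
    -- The nearest point of the cell, obtained by clamping each coordinate.
    set c : EuclideanSpace ℝ (Fin n) := WithLp.toLp 2 fun i => max (-a) (min a (k i / scale n))
      with hc
    refine Set.mem_add.2 ⟨c, (mem_cell hn).2 fun i => ?_, gridPoint k - c, ?_, by abel⟩
    · exact ⟨le_max_left _ _, max_le (by linarith) (min_le_left _ _)⟩
    · rw [mem_closedBall_zero_iff]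
      refine le_of_sq_le_sq ?_ (by positivity)
      rw [hsq, EuclideanSpace.real_norm_sq_eq]
      refine le_trans (Finset.sum_le_sum fun i _ => ?_) hk
      rw [PiLp.sub_apply, gridPoint_apply, ← sq_abs]
      gcongr
      simp only [hc, excess]
      rw [← ha']
      rcases le_total ((k i : ℝ) / scale n) (-a) with h1 | h1
      · rw [min_eq_right (by linarith), max_eq_left h1, abs_of_nonpos (by linarith),
          abs_of_nonpos (by linarith : (k i : ℝ) / scale n ≤ 0)]
        exact le_max_of_le_left (by linarith)
      · rcases le_total ((k i : ℝ) / scale n) a with h2 | h2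
        · rw [min_eq_right h2, max_eq_right h1]
          simp
        · rw [min_eq_left h2, max_eq_right (by linarith), abs_of_nonneg (by linarith),
            abs_of_nonneg (by linarith : 0 ≤ (k i : ℝ) / scale n)]
          exact le_max_left _ _

lemma abs_div_scale_le (hn : 1 ≤ n) {k : Fin n → ℤ} (hk : k ∈ sampleIndices n) (i : Fin n) :
    |(k i : ℝ) / scale n| ≤ 2 * n + 1 / (2 * scale n) := by
  have h1 : excess n (k i) ^ 2 ≤ 4 * n := le_trans
    (Finset.single_le_sum (f := fun i => excess n (k i) ^ 2) (fun i _ => sq_nonneg _)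
      (Finset.mem_univ i)) hk
  have h2 : |(k i : ℝ) / scale n| - 1 / (2 * scale n) ≤ excess n (k i) := le_max_left _ _
  have hn' : (1 : ℝ) ≤ n := by exact_mod_cast hn
  have h3 : excess n (k i) ≤ 2 * n := by
    refine le_of_sq_le_sq ?_ (by positivity)
    nlinarith
  linarith

lemma finite_sampleIndices (hn : 1 ≤ n) : (sampleIndices n).Finite := by
  have hs := scale_pos hn
  set N : ℤ := ⌈(2 * n + 1 / (2 * scale n)) * scale n⌉ with hN
  refine (Set.Finite.pi' fun _ : Fin n => Set.finite_Icc (-N) N).subset fun k hk i => ?_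
  have h := abs_div_scale_le hn hk i
  rw [abs_div, abs_of_pos hs, div_le_iff₀ hs] at h
  have h2 : |(k i : ℝ)| ≤ N := h.trans (Int.le_ceil _)
  have h3 : |k i| ≤ N := by exact_mod_cast h2
  exact abs_le.1 h3

lemma finite_samplePoints (hn : 1 ≤ n) : (samplePoints n).Finite := by
  rw [samplePoints_eq_image hn]
  exact (finite_sampleIndices hn).image _

lemma ncard_samplePoints (hn : 1 ≤ n) :
    (samplePoints n).ncard = (finite_sampleIndices hn).toFinset.card := by
  rw [samplePoints_eq_image hn, Set.ncard_image_of_injective _ (gridPoint_injective hn),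
    Set.ncard_eq_toFinset_card _ (finite_sampleIndices hn)]

lemma ellTilde_eq_sum (hn : 1 ≤ n) (K : Set (EuclideanSpace ℝ (Fin n))) :
    ellTilde K = ∑ k ∈ (finite_sampleIndices hn).toFinset,
      weight (gridPoint k) * gauge K (gridPoint k) := by
  rw [ellTilde, samplePoints_eq_image hn, finsum_mem_image (gridPoint_injective hn).injOn,
    finsum_mem_eq_finite_toFinset_sum _ (finite_sampleIndices hn)]

lemma ellTilde_nonneg (hn : 1 ≤ n) (K : Set (EuclideanSpace ℝ (Fin n))) : 0 ≤ ellTilde K := by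
  rw [ellTilde_eq_sum hn]
  exact Finset.sum_nonneg fun k _ => mul_nonneg (weight_nonneg _) (gauge_nonneg _)

/-! ### Rounding to the grid -/

/-- The index of the nearest grid point. -/
def nearest (x : EuclideanSpace ℝ (Fin n)) : Fin n → ℤ := fun i => ⌊scale n * x i + 1 / 2⌋

lemma nearest_eq_iff (hn : 1 ≤ n) {x : EuclideanSpace ℝ (Fin n)} {k : Fin n → ℤ} :
    nearest x = k ↔
      ∀ i, x i - k i / scale n ∈ Set.Ico (-(1 / (2 * scale n))) (1 / (2 * scale n)) := by
  have hs := scale_pos hn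
  rw [funext_iff]
  refine forall_congr' fun i => ?_
  rw [nearest, Int.floor_eq_iff, Set.mem_Ico]
  have e1 : -(1 / (2 * scale n)) ≤ x i - k i / scale n ↔ (k i : ℝ) ≤ scale n * x i + 1 / 2 := by
    rw [← mul_le_mul_iff_right₀ hs]
    have : scale n * -(1 / (2 * scale n)) = -(1 / 2) := by field_simp
    have h2 : scale n * (x i - k i / scale n) = scale n * x i - k i := by field_simp
    rw [this, h2]
    constructor <;> intro h <;> linarith
  have e2 : x i - k i / scale n < 1 / (2 * scale n) ↔ scale n * x i + 1 / 2 < k i + 1 := by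
    rw [← mul_lt_mul_iff_right₀ hs]
    have : scale n * (1 / (2 * scale n)) = 1 / 2 := by field_simp
    have h2 : scale n * (x i - k i / scale n) = scale n * x i - k i := by field_simp
    rw [this, h2]
    constructor <;> intro h <;> linarith
  rw [e1, e2]

lemma measurableSet_nearest_fiber (k : Fin n → ℤ) :
    MeasurableSet {x : EuclideanSpace ℝ (Fin n) | nearest x = k} := by
  have : Measurable (nearest (n := n)) := by
    refine measurable_pi_lambda _ fun i => Int.measurable_floor.comp ?_
    fun_prop
  exact this (measurableSet_singleton k)

/-- The fibre of `nearest` is a translated half-open cube, which differs from the translated closed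
cell by a null set. The half-open fibres are disjoint, so the cell integrals can be added. -/
lemma setIntegral_cell_gridPoint_add (hn : 1 ≤ n) (k : Fin n → ℤ)
    (f : EuclideanSpace ℝ (Fin n) → ℝ) :
    ∫ y in cell n, f (gridPoint k + y) = ∫ x in {x | nearest x = k}, f x := by
  rw [← (measurePreserving_add_left (volume : Measure (EuclideanSpace ℝ (Fin n)))
    (gridPoint k)).setIntegral_preimage_emb
    (MeasurableEquiv.addLeft (gridPoint k)).measurableEmbedding f {x | nearest x = k}]
  have h := (PiLp.volume_preserving_ofLp (Fin n)).quasiMeasurePreserving.preimage_ae_eq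
    (Measure.univ_pi_Ico_ae_eq_Icc (μ := fun _ : Fin n => (volume : Measure ℝ))
      (f := fun _ => -(1 / (2 * scale n))) (g := fun _ => 1 / (2 * scale n)))
  have e1 : cell n = WithLp.ofLp ⁻¹' Set.Icc (fun _ : Fin n => -(1 / (2 * scale n)))
      (fun _ => 1 / (2 * scale n)) := by
    ext y
    simp only [mem_cell hn, Set.mem_preimage, Set.mem_Icc, Pi.le_def, forall_and]
  have e2 : (fun x => gridPoint k + x) ⁻¹' {x | nearest x = k} = WithLp.ofLp ⁻¹'
      Set.univ.pi fun _ : Fin n => Set.Ico (-(1 / (2 * scale n))) (1 / (2 * scale n)) := by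
    ext y
    simp only [Set.mem_preimage, Set.mem_ofPred_eq, nearest_eq_iff hn, Set.mem_univ_pi,
      PiLp.add_apply, gridPoint_apply, add_sub_cancel_left]
  rw [e1, e2]
  exact setIntegral_congr_set h.symm

lemma sum_setIntegral_cell (hn : 1 ≤ n) (I : Finset (Fin n → ℤ))
    {f : EuclideanSpace ℝ (Fin n) → ℝ} (hf : Integrable f) :
    ∑ k ∈ I, ∫ y in cell n, f (gridPoint k + y) = ∫ x in {x | nearest x ∈ I}, f x := by
  have : {x : EuclideanSpace ℝ (Fin n) | nearest x ∈ I} = ⋃ k ∈ I, {x | nearest x = k} := by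
    ext x; simp
  rw [this, integral_biUnion_finset I (fun k _ => measurableSet_nearest_fiber k) ?_
    fun k _ => hf.integrableOn]
  · exact Finset.sum_congr rfl fun k _ => setIntegral_cell_gridPoint_add hn k f
  · intro k _ l _ hkl
    refine Set.disjoint_left.2 fun x hx hx' => hkl ?_
    rw [← (hx : nearest x = k), ← (hx' : nearest x = l)]

/-- A coordinate and its rounding differ by at most half a cell width, so the excess of the rounding
is at most `|x i|`. Only points outside the ball of radius `2√n` can therefore be lost. -/
lemma nearest_mem_sampleIndices (hn : 1 ≤ n) {x : EuclideanSpace ℝ (Fin n)}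
    (hx : ‖x‖ ^ 2 ≤ 4 * n) : nearest x ∈ sampleIndices n := by
  rw [EuclideanSpace.real_norm_sq_eq] at hx
  refine le_trans (Finset.sum_le_sum fun i _ => ?_) hx
  have h := (nearest_eq_iff hn).1 (rfl : nearest x = nearest x) i
  rw [← sq_abs (x i)]
  gcongr
  · exact excess_nonneg _ _
  · refine max_le ?_ (abs_nonneg _)
    have h1 : |x i - nearest x i / scale n| ≤ 1 / (2 * scale n) := abs_le.2 ⟨h.1, h.2.le⟩
    have h2 := abs_sub_abs_le_abs_sub ((nearest x i : ℝ) / scale n) (x i)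
    rw [abs_sub_comm] at h2
    linarith

/-! ### The two error terms -/

/-- Enlarging `I` to the product of its coordinate projections makes the sum a product of
one-dimensional sums. -/
lemma sum_gaussDensity_gridPoint_le (hn : 1 ≤ n) (I : Finset (Fin n → ℤ))
    (y : EuclideanSpace ℝ (Fin n)) :
    ∑ k ∈ I, gaussDensity (gridPoint k + y) ≤ (scale n * (1 + 2 / (4 * n + 1))) ^ n := by
  classical
  set F : Fin n → Finset ℤ := fun i => I.image fun k => k i
  calc ∑ k ∈ I, gaussDensity (gridPoint k + y)
      ≤ ∑ k ∈ Fintype.piFinset F, gaussDensity (gridPoint k + y) := by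
        refine Finset.sum_le_sum_of_subset_of_nonneg (fun k hk => ?_)
          fun k _ _ => (gaussDensity_pos _).le
        exact Fintype.mem_piFinset.2 fun i => Finset.mem_image_of_mem _ hk
    _ = ∑ k ∈ Fintype.piFinset F, ∏ i, gaussianPDFReal 0 1 (y i + k i / scale n) := by
        refine Finset.sum_congr rfl fun k _ => ?_
        rw [gaussDensity_eq_prod]
        refine Finset.prod_congr rfl fun i _ => ?_
        rw [PiLp.add_apply, gridPoint_apply, add_comm]
    _ = ∏ i, ∑ j ∈ F i, gaussianPDFReal 0 1 (y i + j / scale n) := by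
        rw [Finset.prod_univ_sum]
    _ ≤ ∏ _i : Fin n, (scale n * (1 + 2 / (4 * n + 1))) := by
        refine Finset.prod_le_prod (fun i _ => Finset.sum_nonneg fun j _ =>
          gaussianPDFReal_nonneg _ _ _) fun i _ => sum_gaussianPDFReal_grid_le hn _ _
    _ = _ := by simp

/-- The power is at most `exp(2n/(4n+1)) ≤ √e`, and `(33/20)² > e`. -/
lemma one_add_pow_le (n : ℕ) : (1 + 2 / (4 * n + 1) : ℝ) ^ n ≤ 33 / 20 := by
  have h1 : (1 + 2 / (4 * n + 1) : ℝ) ≤ Real.exp (2 / (4 * n + 1)) := by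
    rw [add_comm]; exact Real.add_one_le_exp _
  calc (1 + 2 / (4 * n + 1) : ℝ) ^ n ≤ Real.exp (2 / (4 * n + 1)) ^ n := by gcongr
    _ = Real.exp (n * (2 / (4 * n + 1))) := by rw [Real.exp_nat_mul]
    _ ≤ Real.exp (1 / 2) := by
        gcongr
        rw [← mul_div_assoc, div_le_div_iff₀ (by positivity) (by norm_num)]
        linarith
    _ ≤ 33 / 20 := by
        refine le_of_sq_le_sq ?_ (by norm_num)
        rw [← Real.exp_nat_mul]
        have := Real.exp_one_lt_d9
        norm_num
        linarith

variable {K : Set (EuclideanSpace ℝ (Fin n))}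

lemma IsSymmConvexBody.sum_rounding_le (hn : 1 ≤ n) (hK : IsSymmConvexBody K)
    (I : Finset (Fin n → ℤ)) :
    ∑ k ∈ I, ∫ y in cell n, gauge K y * gaussDensity (gridPoint k + y) ≤
      11 / 12 / scale n * ell K := by
  have hs := scale_pos hn
  have hc : ∀ k : Fin n → ℤ, Continuous fun y => gauge K y * gaussDensity (gridPoint k + y) :=
    fun k => hK.continuous_gauge.mul (continuous_gaussDensity.comp (by fun_prop))
  set Q := (scale n * (1 + 2 / (4 * n + 1))) ^ n with hQ
  have hg0 : 0 ≤ ∫ y in cell n, gauge K y := integral_nonneg fun _ => gauge_nonneg _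
  calc ∑ k ∈ I, ∫ y in cell n, gauge K y * gaussDensity (gridPoint k + y)
      = ∫ y in cell n, ∑ k ∈ I, gauge K y * gaussDensity (gridPoint k + y) :=
        (integral_finsetSum _ fun k _ => integrableOn_cell hn (hc k)).symm
    _ ≤ ∫ y in cell n, gauge K y * Q := by
        refine integral_mono (integrableOn_cell hn
          (continuous_finsetSum _ fun k _ => hc k))
          (integrableOn_cell hn (hK.continuous_gauge.mul continuous_const)) fun y => ?_
        simp only [← Finset.mul_sum]
        exact mul_le_mul_of_nonneg_left (sum_gaussDensity_gridPoint_le hn I y) (gauge_nonneg _)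
    _ = (1 + 2 / (4 * n + 1)) ^ n * (scale n ^ n * ∫ y in cell n, gauge K y) := by
        rw [integral_mul_const, hQ, mul_pow]; ring
    _ ≤ 33 / 20 * (5 / 9 / scale n * ell K) := by
        refine mul_le_mul (one_add_pow_le n) (hK.setIntegral_cell_gauge_le hn) (by positivity)
          (by norm_num)
    -- Here `33/20 · 5/9 = 11/12`, which leaves `1/12` for the tail.
    _ = _ := by ring

/-- Substituting `x = 2u` gives `2ⁿ` from the volume and one more factor `2` from homogeneity of the
gauge. -/
lemma integral_gauge_mul_gaussDensity_half (K : Set (EuclideanSpace ℝ (Fin n))) :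
    ∫ x, gauge K x * gaussDensity ((1 / 2 : ℝ) • x) = 2 ^ (n + 1) * ell K := by
  have h := Measure.integral_comp_smul_of_nonneg (volume : Measure (EuclideanSpace ℝ (Fin n)))
    (fun x => gauge K x * gaussDensity x) (1 / 2) (hR := by norm_num)
  simp only [gauge_smul_nonneg (by norm_num : (0 : ℝ) ≤ 1 / 2), finrank_euclideanSpace,
    Fintype.card_fin, smul_eq_mul, mul_assoc] at h
  rw [integral_const_mul, one_div, inv_pow, inv_inv] at h
  rw [ell, pow_succ, one_div]
  linarith

lemma IsSymmConvexBody.tail_le (hK : IsSymmConvexBody K) {T : Set (EuclideanSpace ℝ (Fin n))}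
    (hT : ∀ x ∈ Tᶜ, 4 * n ≤ ‖x‖ ^ 2) (hm : MeasurableSet T) :
    ∫ x in Tᶜ, gauge K x * gaussDensity x ≤ 2 * (1 / 2) ^ n * ell K := by
  have hpt : ∀ x ∈ Tᶜ, gaussDensity x ≤ (1 / 4) ^ n * gaussDensity ((1 / 2 : ℝ) • x) := by
    intro x hx
    have h4 := hT x hx
    -- The exponents at `x` and `x/2` differ by `3/8 · ‖x‖² ≥ 3n/2`, and `e³ ≥ 4²`.
    have he : Real.exp (-(3 / 2)) ≤ 1 / 4 := by
      rw [Real.exp_neg, one_div]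
      gcongr
      refine le_of_sq_le_sq ?_ (Real.exp_pos _).le
      have h1 := Real.exp_one_gt_d9
      rw [← Real.exp_nat_mul, show ((2 : ℕ) : ℝ) * (3 / 2) = (3 : ℕ) * 1 by norm_num,
        Real.exp_nat_mul]
      calc (4 : ℝ) ^ 2 ≤ 2.7 ^ 3 := by norm_num
        _ ≤ Real.exp 1 ^ 3 := by gcongr; linarith
    have h5 : Real.exp (-(1 / 2) * ‖x‖ ^ 2) ≤
        (1 / 4) ^ n * Real.exp (-(1 / 2) * ‖(1 / 2 : ℝ) • x‖ ^ 2) := by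
      calc Real.exp (-(1 / 2) * ‖x‖ ^ 2)
          ≤ Real.exp (n * (-(3 / 2)) + -(1 / 2) * ‖(1 / 2 : ℝ) • x‖ ^ 2) := by
            rw [Real.exp_le_exp, norm_smul, mul_pow]
            norm_num
            linarith
        _ = Real.exp (-(3 / 2)) ^ n * Real.exp (-(1 / 2) * ‖(1 / 2 : ℝ) • x‖ ^ 2) := by
            rw [Real.exp_add, Real.exp_nat_mul]
        _ ≤ _ := by gcongr
    unfold gaussDensity
    calc _ ≤ (1 / Real.sqrt (2 * Real.pi)) ^ n *
          ((1 / 4) ^ n * Real.exp (-(1 / 2) * ‖(1 / 2 : ℝ) • x‖ ^ 2)) := by gcongr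
      _ = _ := by ring
  have hi : Integrable fun x => gauge K x * ((1 / 4) ^ n * gaussDensity ((1 / 2 : ℝ) • x)) := by
    refine ((hK.integrable_gauge_mul_exp (b := 1 / 8) (by norm_num)).const_mul
      ((1 / 4) ^ n * (1 / Real.sqrt (2 * Real.pi)) ^ n)).congr (ae_of_all _ fun x => ?_)
    simp only [gaussDensity, norm_smul, mul_pow]
    norm_num
    ring_nf
  calc ∫ x in Tᶜ, gauge K x * gaussDensity x
      ≤ ∫ x in Tᶜ, gauge K x * ((1 / 4) ^ n * gaussDensity ((1 / 2 : ℝ) • x)) :=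
        setIntegral_mono_on hK.integrable_gauge_mul_gaussDensity.integrableOn hi.integrableOn
          hm.compl fun x hx => mul_le_mul_of_nonneg_left (hpt x hx) (gauge_nonneg _)
    _ ≤ ∫ x, gauge K x * ((1 / 4) ^ n * gaussDensity ((1 / 2 : ℝ) • x)) :=
        setIntegral_le_integral hi (ae_of_all _ fun x =>
          mul_nonneg (gauge_nonneg _) (mul_nonneg (by positivity) (gaussDensity_pos _).le))
    _ = (1 / 4) ^ n * (2 ^ (n + 1) * ell K) := by
        rw [← integral_gauge_mul_gaussDensity_half, ← integral_const_mul]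
        refine integral_congr_ae (ae_of_all _ fun x => ?_)
        ring
    _ = _ := by
        rw [pow_succ, show (1 / 4 : ℝ) = 1 / 2 * (1 / 2) by norm_num, mul_pow]
        have : (1 / 2 : ℝ) ^ n * 2 ^ n = 1 := by rw [← mul_pow]; norm_num
        linear_combination 2 * (1 / 2 : ℝ) ^ n * ell K * this

lemma two_mul_half_pow_le (hn : 1 ≤ n) (hs : 1 < scale n) :
    2 * (1 / 2) ^ n ≤ 1 / 12 / scale n := by
  have h := scale_sq hn
  have hp := Real.pi_gt_three
  have hp9 : (9 : ℝ) ≤ Real.pi ^ 2 := by nlinarith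
  have hn' : (1 : ℝ) ≤ n := by exact_mod_cast hn
  have hs2 : 1 < scale n ^ 2 := by nlinarith
  -- From `2π² ≥ 18`. With `s > 1` the logarithm exceeds `18`, which is far more than enough for `n
  -- ≥ 8`, where `24n ≤ 2ⁿ` holds.
  have hlog : 18 * scale n ^ 2 ≤ Real.log (2 * (2 * (n : ℝ) + 1)) := by rw [← h]; nlinarith
  have hn8 : 8 ≤ n := by
    by_contra! hlt
    have h7 : (n : ℝ) ≤ 7 := by exact_mod_cast (by omega : n ≤ 7)
    have h1 : Real.log (2 * (2 * (n : ℝ) + 1)) ≤ Real.log (2 ^ 5) :=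
      Real.log_le_log (by linarith) (by linarith)
    rw [Real.log_pow] at h1
    have := Real.log_two_lt_d9
    norm_num at h1
    linarith
  have hsn : scale n ≤ n := by
    have h2 := Real.log_le_sub_one_of_pos (by linarith : 0 < 2 * (2 * (n : ℝ) + 1))
    refine le_of_sq_le_sq ?_ n.cast_nonneg
    nlinarith
  have h24 : 24 * n ≤ 2 ^ n := by
    induction n, hn8 using Nat.le_induction with
    | base => norm_num
    | succ m hm ih =>
      have : 24 * m ≤ 2 ^ m := by
        clear ih h hs hn hn' hs2 hlog hsn
        induction m, hm using Nat.le_induction with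
        | base => norm_num
        | succ k hk ih => rw [pow_succ]; omega
      rw [pow_succ]; omega
  have h24' : (24 : ℝ) * n ≤ 2 ^ n := by exact_mod_cast h24
  rw [one_div_pow, le_div_iff₀ (by linarith), mul_one_div, div_mul_eq_mul_div,
    div_le_iff₀ (by positivity)]
  linarith

/-- The discrete estimate approximates `ℓ(K)` up to a factor `1 ± 1/s`. -/
theorem ellTilde_bounds (hn : 1 ≤ n) (hK : IsSymmConvexBody K) :
    (1 - 1 / scale n) * ell K ≤ ellTilde K ∧ ellTilde K ≤ (1 + 1 / scale n) * ell K := by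
  have hs := scale_pos hn
  have hell := ell_nonneg K
  set I := (finite_sampleIndices hn).toFinset with hI
  set f : EuclideanSpace ℝ (Fin n) → ℝ := fun x => gauge K x * gaussDensity x with hf
  have hfi : Integrable f := hK.integrable_gauge_mul_gaussDensity
  set T : Set (EuclideanSpace ℝ (Fin n)) := {x | nearest x ∈ I} with hT
  have hTm : MeasurableSet T := by
    have : T = ⋃ k ∈ I, {x | nearest x = k} := by ext x; simp [hT]
    rw [this]
    exact Finset.measurableSet_biUnion _ fun k _ => measurableSet_nearest_fiber k
  have hA := sum_setIntegral_cell hn I hfi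
  have hB := hK.sum_rounding_le hn I
  have hcont1 : ∀ k : Fin n → ℤ, IntegrableOn (fun y => f (gridPoint k + y)) (cell n) := fun k =>
    integrableOn_cell hn
      ((hK.continuous_gauge.mul continuous_gaussDensity).comp (by fun_prop))
  have hcont2 : ∀ k : Fin n → ℤ,
      IntegrableOn (fun y => gauge K y * gaussDensity (gridPoint k + y)) (cell n) := fun k =>
    integrableOn_cell hn
      (hK.continuous_gauge.mul (continuous_gaussDensity.comp (by fun_prop)))
  have hcont3 : ∀ k : Fin n → ℤ,
      IntegrableOn (fun y => gauge K (gridPoint k) * gaussDensity (gridPoint k + y)) (cell n) :=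
    fun k => integrableOn_cell hn
      (continuous_const.mul (continuous_gaussDensity.comp (by fun_prop)))
  have hterm : ∀ k : Fin n → ℤ, weight (gridPoint k) * gauge K (gridPoint k) =
      ∫ y in cell n, gauge K (gridPoint k) * gaussDensity (gridPoint k + y) := by
    intro k
    rw [integral_const_mul, weight, mul_comm]
  have hcompl : (∫ x in T, f x) + ∫ x in Tᶜ, f x = ell K := integral_add_compl hTm hfi
  have hf0 : ∀ x, 0 ≤ f x := fun x => mul_nonneg (gauge_nonneg _) (gaussDensity_pos _).le
  have h12 : 1 / scale n * ell K = 11 / 12 / scale n * ell K + 1 / 12 / scale n * ell K := by ring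
  have h112 : 0 ≤ 1 / 12 / scale n * ell K := by positivity
  constructor
  -- If `s ≤ 1` the factor `1 - 1/s` is nonpositive; the tail estimate is needed only for `s > 1`.
  · rcases le_or_gt (scale n) 1 with h1 | h1
    · have : 1 - 1 / scale n ≤ 0 := by
        rw [sub_nonpos, le_div_iff₀ hs]; linarith
      exact (mul_nonpos_of_nonpos_of_nonneg this hell).trans (ellTilde_nonneg hn K)
    · have htail : ∫ x in Tᶜ, f x ≤ 1 / 12 / scale n * ell K := by
        refine (hK.tail_le (fun x hx => ?_) hTm).trans
          (mul_le_mul_of_nonneg_right (two_mul_half_pow_le hn h1) hell)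
        by_contra! hlt
        exact hx ((finite_sampleIndices hn).mem_toFinset.2 (nearest_mem_sampleIndices hn hlt.le))
      have hlow : ∫ x in T, f x ≤ ellTilde K +
          ∑ k ∈ I, ∫ y in cell n, gauge K y * gaussDensity (gridPoint k + y) := by
        rw [← hA, ellTilde_eq_sum hn, ← Finset.sum_add_distrib]
        refine Finset.sum_le_sum fun k _ => ?_
        rw [hterm, ← integral_add (hcont3 k) (hcont2 k)]
        refine integral_mono (hcont1 k) ((hcont3 k).add (hcont2 k)) fun y => ?_
        simp only [hf, ← add_mul]
        exact mul_le_mul_of_nonneg_right (hK.gauge_add_le _ _) (gaussDensity_pos _).le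
      rw [sub_mul, one_mul, h12]
      linarith
  · have hupp : ellTilde K ≤ (∫ x in T, f x) +
        ∑ k ∈ I, ∫ y in cell n, gauge K y * gaussDensity (gridPoint k + y) := by
      rw [← hA, ellTilde_eq_sum hn, ← Finset.sum_add_distrib]
      refine Finset.sum_le_sum fun k _ => ?_
      rw [hterm, ← integral_add (hcont1 k) (hcont2 k)]
      refine integral_mono (hcont3 k) ((hcont1 k).add (hcont2 k)) fun y => ?_
      simp only [hf, ← add_mul]
      exact mul_le_mul_of_nonneg_right (hK.gauge_le_add_sub _ _) (gaussDensity_pos _).le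
    have : 0 ≤ ∫ x in Tᶜ, f x := integral_nonneg fun x => hf0 x
    rw [add_mul, one_mul, h12]
    linarith

/-! ### The number of sample points -/

lemma norm_gridPoint_sq_le (hn : 1 ≤ n) {k : Fin n → ℤ} (hk : k ∈ sampleIndices n) :
    ‖gridPoint k‖ ^ 2 ≤ 16 * n := by
  have hs := scale_pos hn
  have ha : 1 / (2 * scale n) ≤ 2 := by
    rw [div_le_iff₀ (by positivity)]
    linarith [quarter_le_scale hn]
  have hle : ∀ i, gridPoint k i ^ 2 ≤ 2 * excess n (k i) ^ 2 + 8 := by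
    intro i
    have h1 : |(k i : ℝ) / scale n| - 1 / (2 * scale n) ≤ excess n (k i) := le_max_left _ _
    have h2 : |gridPoint k i| ≤ excess n (k i) + 2 := by rw [gridPoint_apply]; linarith
    have h3 := abs_nonneg (gridPoint k i)
    rw [← sq_abs]
    nlinarith [sq_nonneg (excess n (k i) - 2)]
  have hk' : ∑ i, excess n (k i) ^ 2 ≤ 4 * n := hk
  rw [EuclideanSpace.real_norm_sq_eq]
  refine (Finset.sum_le_sum fun i _ => hle i).trans ?_
  rw [Finset.sum_add_distrib, ← Finset.mul_sum]
  simp only [Finset.sum_const, Finset.card_univ, Fintype.card_fin, nsmul_eq_mul]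
  linarith

/-- The base of the exponential bound for the number of sample points. -/
def countBase : ℝ := 2 * Real.sqrt (2 * Real.pi) * Real.exp 8

lemma countBase_pos : 0 < countBase := by unfold countBase; positivity

/-- At each sample point the density is at least `cⁿ`, whereas the densities over the grid sum to at
most `(2s)ⁿ`; `countBase` is `2/c`. -/
lemma card_sampleIndices_le (hn : 1 ≤ n) :
    ((finite_sampleIndices hn).toFinset.card : ℝ) ≤ (countBase * scale n) ^ n := by
  have hs := scale_pos hn
  have hn' : (1 : ℝ) ≤ n := by exact_mod_cast hn
  set I := (finite_sampleIndices hn).toFinset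
  set c : ℝ := 1 / Real.sqrt (2 * Real.pi) * Real.exp (-8) with hc
  have hc0 : 0 < c := by positivity
  have hlow : ∀ k ∈ I, c ^ n ≤ gaussDensity (gridPoint k + 0) := by
    intro k hk
    have h := norm_gridPoint_sq_le hn ((finite_sampleIndices hn).mem_toFinset.1 hk)
    rw [add_zero, gaussDensity, hc, mul_pow, ← Real.exp_nat_mul]
    refine mul_le_mul_of_nonneg_left (Real.exp_le_exp.2 ?_) (by positivity)
    linarith
  have h1 : (I.card : ℝ) * c ^ n ≤ (scale n * (1 + 2 / (4 * n + 1))) ^ n := by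
    refine le_trans ?_ (sum_gaussDensity_gridPoint_le hn I 0)
    rw [← nsmul_eq_mul]
    exact Finset.card_nsmul_le_sum _ _ _ hlow
  have h2 : (1 + 2 / (4 * n + 1) : ℝ) ≤ 2 := by
    have : (2 / (4 * n + 1) : ℝ) ≤ 1 := by rw [div_le_one (by positivity)]; linarith
    linarith
  have h3 : countBase * scale n * c = scale n * 2 := by
    have : Real.exp 8 * Real.exp (-8) = 1 := by rw [← Real.exp_add]; simp
    rw [countBase, hc]
    have hp : Real.sqrt (2 * Real.pi) ≠ 0 := by positivity
    field_simp
    linear_combination this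
  have h4 : (I.card : ℝ) * c ^ n ≤ (countBase * scale n) ^ n * c ^ n := by
    rw [← mul_pow, h3]
    exact h1.trans (by gcongr)
  exact le_of_mul_le_mul_right h4 (by positivity)

lemma card_sampleIndices_le_sqrt_log (hn : 2 ≤ n) :
    ((finite_sampleIndices (by omega : 1 ≤ n)).toFinset.card : ℝ) ≤
      (countBase * Real.sqrt (Real.log n)) ^ n := by
  refine (card_sampleIndices_le (by omega : 1 ≤ n)).trans ?_
  have := scale_le_sqrt_log hn
  have := countBase_pos
  have := scale_pos (by omega : 1 ≤ n)
  gcongr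

/-! ### The program

Integer memory: `0` holds `n`, `1` the active coordinate, `2` the inner counter, and `3 + j` the
`j`-th integer coordinate of the current grid point. Real memory: `0` holds the partial sum, `1` the
scale, `2` the squared distance to the cell, `3` the weight, `4` the norm, and `5 + j` the `j`-th
coordinate of the current grid point. -/

/-- The program text for `s`. -/
def scaleExp : RExp :=
  .times (.over (.const 1) (.sqrt (.times (.const 2) .pi)))
    (.sqrt (.over (.log (.times (.const 2)
      (.plus (.times (.const 2) (.ofInt (.load (.const 0)))) (.const 1)))) .pi))

/-- The program text for `1 / (2s)`. -/
def halfWidthExp : RExp := .over (.const 1) (.times (.const 2) (.load (.const 1)))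

/-- The coordinate of the current grid point at the inner counter. -/
def coordExp : RExp := .load (.plus (.const 5) (.load (.const 2)))

/-- The excess of `|x|` over `1 / (2s)`, possibly negative. -/
def gapExp : RExp := .minus (.sqrt (.times coordExp coordExp)) halfWidthExp

/-- The positive part of `gapExp`. -/
def excessExp : RExp :=
  .over (.plus gapExp (.sqrt (.times gapExp gapExp))) (.const 2)

/-- Process one coordinate of the current grid point. -/
def coordStep : Cmd :=
  .seq (.setReal (.plus (.const 5) (.load (.const 2)))
    (.over (.ofInt (.load (.plus (.const 3) (.load (.const 2))))) (.load (.const 1))))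
  (.seq (.setReal (.const 2) (.plus (.load (.const 2)) (.times excessExp excessExp)))
  (.seq (.setReal (.const 3) (.times (.load (.const 3))
    (.minus (.normalCdf (.plus coordExp halfWidthExp))
      (.normalCdf (.minus coordExp halfWidthExp)))))
  (.setInt (.const 2) (.plus (.load (.const 2)) (.const 1)))))

/-- Process all coordinates of the current grid point. -/
def coordLoop : Cmd :=
  .loop (.ile (.plus (.load (.const 2)) (.const 1)) (.load (.const 0))) coordStep

/-- The active integer coordinate. -/
def activeAddr : IExp := .plus (.const 3) (.load (.const 1))

/-- Move the active coordinate to its successor in the order `0, 1, -1, 2, -2, …`. -/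
def advance : Cmd :=
  .cond (.ile (.load activeAddr) (.const 0))
    (.setInt activeAddr (.minus (.const 1) (.load activeAddr)))
    (.setInt activeAddr (.minus (.const 0) (.load activeAddr)))

/-- Add the contribution of the current grid point and activate the last coordinate. -/
def accept : Cmd :=
  .seq (.query (.const 4) (.const 5))
  (.seq (.setReal (.const 0)
    (.plus (.load (.const 0)) (.times (.load (.const 3)) (.load (.const 4)))))
  (.setInt (.const 1) (.minus (.load (.const 0)) (.const 1))))

/-- Reset the active coordinate and activate the preceding one. -/
def backtrack : Cmd :=
  .seq (.setInt activeAddr (.const 0))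
  (.setInt (.const 1) (.minus (.load (.const 1)) (.const 1)))

/-- The body of the enumeration. -/
def visit : Cmd :=
  .seq advance
  (.seq (.setInt (.const 2) (.const 0))
  (.seq (.setReal (.const 2) (.const 0))
  (.seq (.setReal (.const 3) (.const 1))
  (.seq coordLoop
  (.cond (.rle (.load (.const 2)) (.times (.const 4) (.ofInt (.load (.const 0)))))
    accept backtrack)))))

/-- The enumeration of all sample points. -/
def enumerate : Cmd := .loop (.ile (.const 0) (.load (.const 1))) visit

/-- The program which computes the discrete estimate. -/
def estimator : Cmd :=
  .seq (.setReal (.const 1) scaleExp)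
  (.seq (.setInt (.const 1) (.minus (.load (.const 0)) (.const 1))) enumerate)

/-! ### Correctness and cost of a single visit -/

lemma eval_scaleExp {σ : Store} (h0 : σ.int 0 = n) : scaleExp.eval σ = scale n := by
  simp [scaleExp, scale, RExp.eval, IExp.eval, h0]

/-- Absolute values are computed as `√(x·x)`, and the positive part of `y` as `(y + |y|)/2`. -/
lemma eval_excessExp {σ : Store} {c : ℕ} {k : ℤ} (h1 : σ.real 1 = scale n)
    (h2 : σ.int 2 = c) (hx : σ.real (5 + c) = k / scale n) :
    excessExp.eval σ = excess n k := by
  have hc : (5 + (c : ℤ)).toNat = 5 + c := by omega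
  have hco : coordExp.eval σ = k / scale n := by
    simp [coordExp, RExp.eval, IExp.eval, h2, hc, hx]
  have hg : gapExp.eval σ = |(k : ℝ) / scale n| - 1 / (2 * scale n) := by
    simp only [gapExp, halfWidthExp, RExp.eval, IExp.eval, hco, Real.sqrt_mul_self_eq_abs]
    simp [h1]
  simp only [excessExp, RExp.eval, hg, Real.sqrt_mul_self_eq_abs, excess]
  set y := |(k : ℝ) / scale n| - 1 / (2 * scale n)
  rcases le_total y 0 with h | h
  · rw [abs_of_nonpos h, max_eq_right h]; simp
  · rw [abs_of_nonneg h, max_eq_left h]; simp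

/-- The weight factor of the coordinate `k / s`. -/
def factor (n : ℕ) (k : ℤ) : ℝ :=
  cdf (gaussianReal 0 1) (k / scale n + 1 / (2 * scale n)) -
    cdf (gaussianReal 0 1) (k / scale n - 1 / (2 * scale n))

/-- `τ` differs from `σ` only in the scratch memory. -/
structure Frame (σ τ : Store) : Prop where
  int : ∀ j, j ≠ 2 → τ.int j = σ.int j
  real_zero : τ.real 0 = σ.real 0
  real_one : τ.real 1 = σ.real 1

lemma Frame.refl (σ : Store) : Frame σ σ := ⟨fun _ _ => rfl, rfl, rfl⟩

lemma Frame.trans {σ τ υ : Store} (h : Frame σ τ) (g : Frame τ υ) : Frame σ υ :=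
  ⟨fun j hj => (g.int j hj).trans (h.int j hj), g.real_zero.trans h.real_zero,
    g.real_one.trans h.real_one⟩

/-- `c` runs from `σ` to `τ` in at most `T` steps. -/
def Runs (K : Set (EuclideanSpace ℝ (Fin n))) (c : Cmd) (σ τ : Store) (T : ℕ) : Prop :=
  ∃ t ≤ T, Exec K c σ τ t

lemma Runs.seq {c d : Cmd} {σ τ υ : Store} {T U : ℕ} (h : Runs K c σ τ T) (g : Runs K d τ υ U) :
    Runs K (.seq c d) σ υ (T + U) := by
  obtain ⟨t, ht, h⟩ := h
  obtain ⟨u, hu, g⟩ := g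
  exact ⟨t + u, by omega, h.seq g⟩

lemma Runs.mono {c : Cmd} {σ τ : Store} {T U : ℕ} (h : Runs K c σ τ T) (hTU : T ≤ U) :
    Runs K c σ τ U := by
  obtain ⟨t, ht, h⟩ := h
  exact ⟨t, ht.trans hTU, h⟩

lemma runs_setReal {addr : IExp} {a : RExp} {σ : Store} {i : ℕ} {v : ℝ}
    (hi : (addr.eval σ).toNat = i) (hv : a.eval σ = v) :
    Runs K (.setReal addr a) σ (σ.setReal i v) (addr.cost + a.cost + 1) := by
  subst hi hv
  exact ⟨_, le_rfl, .setReal addr a σ⟩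

lemma runs_setInt {addr e : IExp} {σ : Store} {i : ℕ} {v : ℤ}
    (hi : (addr.eval σ).toNat = i) (hv : e.eval σ = v) :
    Runs K (.setInt addr e) σ (σ.setInt i v) (addr.cost + e.cost + 1) := by
  subst hi hv
  exact ⟨_, le_rfl, .setInt addr e σ⟩

lemma runs_condTrue {b : Test} {c d : Cmd} {σ τ : Store} {T : ℕ} (hb : b.holds σ)
    (h : Runs K c σ τ T) : Runs K (.cond b c d) σ τ (b.cost + T) := by
  obtain ⟨t, ht, h⟩ := h
  exact ⟨_, by omega, .condTrue hb h⟩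

lemma runs_condFalse {b : Test} {c d : Cmd} {σ τ : Store} {T : ℕ} (hb : ¬ b.holds σ)
    (h : Runs K d σ τ T) : Runs K (.cond b c d) σ τ (b.cost + T) := by
  obtain ⟨t, ht, h⟩ := h
  exact ⟨_, by omega, .condFalse hb h⟩

lemma runs_loopDone {b : Test} {c : Cmd} {σ : Store} (hb : ¬ b.holds σ) :
    Runs K (.loop b c) σ σ b.cost := ⟨_, le_rfl, .loopDone hb⟩

lemma runs_loopStep {b : Test} {c : Cmd} {σ τ υ : Store} {T U : ℕ} (hb : b.holds σ)
    (h : Runs K c σ τ T) (g : Runs K (.loop b c) τ υ U) :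
    Runs K (.loop b c) σ υ (b.cost + T + U) := by
  obtain ⟨t, ht, h⟩ := h
  obtain ⟨u, hu, g⟩ := g
  exact ⟨_, by omega, .loopStep hb h g⟩

@[simp] lemma Store.setReal_int (σ : Store) (i : ℕ) (v : ℝ) : (σ.setReal i v).int = σ.int := rfl

@[simp] lemma Store.setInt_real (σ : Store) (i : ℕ) (v : ℤ) : (σ.setInt i v).real = σ.real := rfl

lemma Store.setReal_real (σ : Store) (i j : ℕ) (v : ℝ) :
    (σ.setReal i v).real j = if j = i then v else σ.real j := Function.update_apply _ _ _ _

lemma Store.setInt_int (σ : Store) (i j : ℕ) (v : ℤ) :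
    (σ.setInt i v).int j = if j = i then v else σ.int j := Function.update_apply _ _ _ _

lemma runs_coordStep {σ : Store} {c : ℕ} (h1 : σ.real 1 = scale n) (h2 : σ.int 2 = c) :
    ∃ τ, Runs K coordStep σ τ 300 ∧ Frame σ τ ∧ τ.int 2 = c + 1 ∧
      τ.real 2 = σ.real 2 + excess n (σ.int (3 + c)) ^ 2 ∧
      τ.real 3 = σ.real 3 * factor n (σ.int (3 + c)) ∧
      τ.real (5 + c) = σ.int (3 + c) / scale n ∧
      ∀ j < c, τ.real (5 + j) = σ.real (5 + j) := by
  have hc5 : (5 + (c : ℤ)).toNat = 5 + c := by omega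
  have hc3 : (3 + (c : ℤ)).toNat = 3 + c := by omega
  set σ₁ := σ.setReal (5 + c) (σ.int (3 + c) / scale n) with hσ₁
  have a1 : σ₁.real 1 = scale n := by
    rw [hσ₁, Store.setReal_real, if_neg (by omega), h1]
  have ax : σ₁.real (5 + c) = σ.int (3 + c) / scale n := by
    rw [hσ₁, Store.setReal_real, if_pos rfl]
  set σ₂ := σ₁.setReal 2 (σ.real 2 + excess n (σ.int (3 + c)) ^ 2) with hσ₂
  have b1 : σ₂.real 1 = scale n := by
    rw [hσ₂, Store.setReal_real, if_neg (by omega), a1]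
  have bx : σ₂.real (5 + c) = σ.int (3 + c) / scale n := by
    rw [hσ₂, Store.setReal_real, if_neg (by omega), ax]
  have b3 : σ₂.real 3 = σ.real 3 := by
    rw [hσ₂, Store.setReal_real, if_neg (by omega), hσ₁, Store.setReal_real, if_neg (by omega)]
  set σ₃ := σ₂.setReal 3 (σ.real 3 * factor n (σ.int (3 + c))) with hσ₃
  refine ⟨σ₃.setInt 2 (c + 1), ((runs_setReal (i := 5 + c) ?_ ?_).seq ((runs_setReal (i := 2)
    ?_ ?_).seq ((runs_setReal (i := 3) ?_ ?_).seq (runs_setInt (i := 2) ?_ ?_)))).mono (by decide),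
    ⟨fun j hj => ?_, ?_, ?_⟩, ?_, ?_, ?_, ?_, fun j hj => ?_⟩
  · simp [IExp.eval, h2, hc5]
  · simp [RExp.eval, IExp.eval, h1, h2, hc3]
  · rfl
  · have hr : σ₁.real 2 = σ.real 2 := by
      rw [hσ₁, Store.setReal_real, if_neg (by omega)]
    change σ₁.real 2 + excessExp.eval σ₁ * excessExp.eval σ₁ = _
    rw [eval_excessExp a1 h2 ax, hr, sq]
  · rfl
  · have hco : coordExp.eval σ₂ = σ.int (3 + c) / scale n := by
      simp [coordExp, RExp.eval, IExp.eval, hσ₂, hσ₁, h2, hc5]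
      simpa [hσ₂, hσ₁] using bx
    have hw : halfWidthExp.eval σ₂ = 1 / (2 * scale n) := by
      simp [halfWidthExp, RExp.eval, IExp.eval, b1]
    change σ₂.real 3 * (cdf (gaussianReal 0 1) (coordExp.eval σ₂ + halfWidthExp.eval σ₂) -
      cdf (gaussianReal 0 1) (coordExp.eval σ₂ - halfWidthExp.eval σ₂)) = _
    rw [hco, hw, b3, factor]
  · rfl
  · simp [IExp.eval, h2]
  · rw [Store.setInt_int, if_neg hj]; rfl
  · simp only [hσ₃, hσ₂, hσ₁, Store.setReal_real, Store.setInt_real]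
    rw [if_neg (by omega), if_neg (by omega), if_neg (by omega)]
  · simp [hσ₃, b1, h1, Store.setReal_real]
  · simp [Store.setInt_int]
  · simp [hσ₃, hσ₂, Store.setReal_real]
  · simp [hσ₃, Store.setReal_real]
  · rw [Store.setInt_real, hσ₃, Store.setReal_real, if_neg (by omega), bx]
  · rw [Store.setInt_real, hσ₃, hσ₂, hσ₁, Store.setReal_real, Store.setReal_real,
      Store.setReal_real, if_neg (by omega), if_neg (by omega), if_neg (by omega)]

/-- The start `c` is arbitrary so that induction on the number `m` of remaining coordinates applies;
the visit uses `c = 0`. -/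
lemma runs_coordLoop_from {σ : Store} (m c : ℕ) (hcm : c + m = n) (h0 : σ.int 0 = n)
    (h1 : σ.real 1 = scale n) (h2 : σ.int 2 = c)
    (hx : ∀ j < c, σ.real (5 + j) = σ.int (3 + j) / scale n) :
    ∃ τ, Runs K coordLoop σ τ (310 * m + 10) ∧ Frame σ τ ∧
      τ.real 2 = σ.real 2 + ∑ j ∈ Finset.Ico c n, excess n (σ.int (3 + j)) ^ 2 ∧
      τ.real 3 = σ.real 3 * ∏ j ∈ Finset.Ico c n, factor n (σ.int (3 + j)) ∧
      ∀ j < n, τ.real (5 + j) = σ.int (3 + j) / scale n := by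
  induction m generalizing c σ with
  | zero =>
    have hc : c = n := by omega
    subst hc
    refine ⟨σ, (runs_loopDone ?_).mono (by decide), Frame.refl σ, by simp, by simp, hx⟩
    simp [Test.holds, IExp.eval, h0, h2]
  | succ m ih =>
    obtain ⟨τ, hτ, hf, t2, t2r, t3r, tx, tlt⟩ := runs_coordStep (K := K) h1 h2
    have hint : ∀ j, τ.int (3 + j) = σ.int (3 + j) := fun j => hf.int _ (by omega)
    obtain ⟨υ, hυ, hf', u2, u3, ux⟩ := ih (σ := τ) (c + 1) (by omega)
      ((hf.int 0 (by omega)).trans h0) (hf.real_one.trans h1) (by rw [t2]; push_cast; rfl) (by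
        intro j hj
        rw [hint]
        rcases Nat.lt_succ_iff_lt_or_eq.1 hj with h | rfl
        · rw [tlt j h, hx j h]
        · exact tx)
    refine ⟨υ, (runs_loopStep ?_ hτ hυ).mono ?_, hf.trans hf', ?_, ?_, ?_⟩
    · simp only [Test.holds, IExp.eval]
      simp [h0, h2]; omega
    · have : (Test.ile (.plus (.load (.const 2)) (.const 1)) (.load (.const 0))).cost = 7 := rfl
      omega
    · rw [u2, t2r, Finset.sum_eq_sum_Ico_succ_bot (by omega : c < n), add_assoc]
      simp_rw [hint]
    · rw [u3, t3r, Finset.prod_eq_prod_Ico_succ_bot (by omega : c < n), mul_assoc]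
      simp_rw [hint]
    · simpa only [hint] using ux

/-- The store holds the integer vector `k`, the partial sum `A` and the active coordinate `i`. -/
structure Holds (σ : Store) (k : Fin n → ℤ) (A : ℝ) (i : ℤ) : Prop where
  dim : σ.int 0 = n
  active : σ.int 1 = i
  coord : ∀ j : Fin n, σ.int (3 + j) = k j
  acc : σ.real 0 = A
  scale : σ.real 1 = scale n

/-- The successor in the order `0, 1, -1, 2, -2, …`. -/
def zigzag (v : ℤ) : ℤ := if v ≤ 0 then 1 - v else -v

/-- The contribution of a grid point. -/
def contrib (K : Set (EuclideanSpace ℝ (Fin n))) (k : Fin n → ℤ) : ℝ :=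
  weight (gridPoint k) * gauge K (gridPoint k)

lemma runs_advance {σ : Store} {k : Fin n → ℤ} {A : ℝ} {i : Fin n} (h : Holds σ k A i) :
    ∃ τ, Runs K advance σ τ 100 ∧ Holds τ (Function.update k i (zigzag (k i))) A i := by
  have ha : ((activeAddr.eval σ)).toNat = 3 + i := by
    simp [activeAddr, IExp.eval, h.active]; omega
  have hk := h.coord i
  refine ⟨σ.setInt (3 + i) (zigzag (k i)), ?_, ⟨?_, ?_, fun j => ?_, h.acc, h.scale⟩⟩
  · by_cases hle : k i ≤ 0
    · refine (runs_condTrue ?_ (runs_setInt ha ?_)).mono (by decide)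
      · simp only [Test.holds, IExp.eval, ha, hk]; exact hle
      · simp only [IExp.eval, ha, hk, zigzag, if_pos hle]
    · refine (runs_condFalse ?_ (runs_setInt ha ?_)).mono (by decide)
      · simp only [Test.holds, IExp.eval, ha, hk]; exact hle
      · simp only [IExp.eval, ha, hk, zigzag, if_neg hle]; ring
  · rw [Store.setInt_int, if_neg (by omega), h.dim]
  · rw [Store.setInt_int, if_neg (by omega), h.active]
  · rw [Store.setInt_int, Function.update_apply, h.coord]
    simp only [Nat.add_left_cancel_iff, Fin.ext_iff]

lemma runs_visit (hn : 1 ≤ n) {σ : Store} {k : Fin n → ℤ} {A : ℝ} {i : Fin n}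
    (h : Holds σ k A i) :
    ∃ τ, Runs K visit σ τ (600 * n) ∧
      (Function.update k i (zigzag (k i)) ∈ sampleIndices n →
        Holds τ (Function.update k i (zigzag (k i)))
          (A + contrib K (Function.update k i (zigzag (k i)))) (n - 1)) ∧
      (Function.update k i (zigzag (k i)) ∉ sampleIndices n →
        Holds τ (Function.update k i 0) A (i - 1)) := by
  obtain ⟨σ₁, hr, h'⟩ := runs_advance (K := K) h
  set l := Function.update k i (zigzag (k i)) with hl
  set σ₂ := ((σ₁.setInt 2 0).setReal 2 0).setReal 3 1 with hσ₂
  have hH : Holds σ₂ l A i := by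
    refine ⟨?_, ?_, fun j => ?_, ?_, ?_⟩
    · simp [hσ₂, Store.setInt_int, h'.dim]
    · simp [hσ₂, Store.setInt_int, h'.active]
    · simp only [hσ₂, Store.setReal_int]
      rw [Store.setInt_int, if_neg (by omega), h'.coord]
    · simp [hσ₂, Store.setReal_real, h'.acc]
    · simp [hσ₂, Store.setReal_real, h'.scale]
  obtain ⟨υ, hυ, hf, u2, u3, ux⟩ := runs_coordLoop_from (K := K) (σ := σ₂) n 0 (by omega) hH.dim
    hH.scale (by simp [hσ₂, Store.setInt_int]) (by simp)
  have hυH : Holds υ l A i :=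
    ⟨(hf.int 0 (by omega)).trans hH.dim, (hf.int 1 (by omega)).trans hH.active,
      fun j => (hf.int _ (by omega)).trans (hH.coord j), hf.real_zero.trans hH.acc,
      hf.real_one.trans hH.scale⟩
  have u2' : υ.real 2 = ∑ j, excess n (l j) ^ 2 := by
    rw [u2, Nat.Ico_zero_eq_range, Finset.sum_range]
    simp [hσ₂, Store.setReal_real, ← hH.coord]
  have u3' : υ.real 3 = weight (gridPoint l) := by
    rw [u3, Nat.Ico_zero_eq_range, Finset.prod_range, weight_eq_prod hn]
    simp [hσ₂, Store.setReal_real, ← hH.coord, factor]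
  have hvec : υ.vec n 5 = gridPoint l := by
    ext j
    simp only [Store.vec, gridPoint_apply, ← hH.coord j]
    exact ux j j.2
  have htest : (Test.rle (.load (.const 2)) (.times (.const 4) (.ofInt (.load (.const 0))))).holds υ ↔
      l ∈ sampleIndices n := by
    simp only [Test.holds, RExp.eval, IExp.eval, sampleIndices, Set.mem_ofPred_eq]
    simp [u2', hυH.dim]
  have hpre : ∀ {c : Cmd} {τ : Store} {T : ℕ}, Runs K c υ τ T →
      Runs K (.seq advance (.seq (.setInt (.const 2) (.const 0)) (.seq (.setReal (.const 2) (.const 0))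
        (.seq (.setReal (.const 3) (.const 1)) (.seq coordLoop c))))) σ τ
        (100 + (3 + (3 + (3 + (310 * n + 10 + T))))) := fun {c τ T} hc =>
    hr.seq ((runs_setInt rfl rfl).seq ((runs_setReal rfl (by simp [RExp.eval])).seq
      ((runs_setReal rfl (by simp [RExp.eval])).seq (hυ.seq hc))))
  by_cases hmem : l ∈ sampleIndices n
  · set τ₁ := υ.setReal 4 (gauge K (gridPoint l)) with hτ₁
    set τ₂ := τ₁.setReal 0 (A + contrib K l) with hτ₂
    have hq : Runs K (.query (.const 4) (.const 5)) υ τ₁ (n + 3) := by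
      have := Exec.query (K := K) (.const 4) (.const 5) υ
      simp only [IExp.eval] at this
      rw [show (5 : ℤ).toNat = 5 from rfl, hvec] at this
      exact ⟨_, by simp only [IExp.cost]; omega, this⟩
    have hacc : Runs K accept υ (τ₂.setInt 1 (n - 1)) (n + 30) := by
      refine (hq.seq ((runs_setReal (i := 0) rfl ?_).seq (runs_setInt (i := 1) rfl ?_))).mono ?_
      · simp [RExp.eval, IExp.eval, hτ₁, Store.setReal_real, u3', hυH.acc, contrib]
      · simp [IExp.eval, hτ₁, hυH.dim]
      · simp only [IExp.cost, RExp.cost]; omega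
    refine ⟨_, (hpre (runs_condTrue (htest.2 hmem) hacc)).mono ?_, fun _ => ?_,
      fun hnot => absurd hmem hnot⟩
    · simp only [Test.cost, IExp.cost, RExp.cost]; omega
    · refine ⟨?_, ?_, fun j => ?_, ?_, ?_⟩
      · simp [hτ₂, hτ₁, Store.setInt_int, hυH.dim]
      · simp [Store.setInt_int]
      · rw [Store.setInt_int, if_neg (by omega)]; exact hυH.coord j
      · simp [hτ₂, Store.setReal_real]
      · simp [hτ₂, hτ₁, Store.setReal_real, hυH.scale]
  · have ha : ((activeAddr.eval υ)).toNat = 3 + i := by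
      simp [activeAddr, IExp.eval, hυH.active]; omega
    have hback : Runs K backtrack υ ((υ.setInt (3 + i) 0).setInt 1 (i - 1)) 20 := by
      refine ((runs_setInt ha rfl).seq (runs_setInt (i := 1) rfl ?_)).mono (by decide)
      simp [IExp.eval, Store.setInt_int, hυH.active]; omega
    refine ⟨_, (hpre (runs_condFalse (fun hb => hmem (htest.1 hb)) hback)).mono ?_,
      fun hyes => absurd hyes hmem, fun _ => ?_⟩
    · simp only [Test.cost, IExp.cost, RExp.cost]; omega
    · refine ⟨?_, ?_, fun j => ?_, hυH.acc, hυH.scale⟩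
      · rw [Store.setInt_int, if_neg (by omega), Store.setInt_int, if_neg (by omega), hυH.dim]
      · simp [Store.setInt_int]
      · rw [Store.setInt_int, if_neg (by omega), Store.setInt_int, hυH.coord, hl]
        simp only [Nat.add_left_cancel_iff, Function.update_apply, Fin.ext_iff]
        split_ifs <;> rfl

/-! ### The backtracking search -/

/-- The enumeration started in `σ` passes through `τ` after at most `T` steps. -/
def Leads (K : Set (EuclideanSpace ℝ (Fin n))) (σ τ : Store) (T : ℕ) : Prop :=
  ∀ υ U, Runs K enumerate τ υ U → Runs K enumerate σ υ (T + U)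

lemma Leads.trans {σ τ υ : Store} {T U : ℕ} (h : Leads K σ τ T) (g : Leads K τ υ U) :
    Leads K σ υ (T + U) := fun ω V hω => by
  rw [add_assoc]; exact h _ _ (g _ _ hω)

lemma Leads.mono {σ τ : Store} {T U : ℕ} (h : Leads K σ τ T) (hTU : T ≤ U) : Leads K σ τ U :=
  fun ω V hω => (h ω V hω).mono (by omega)

lemma leads_visit (hn : 1 ≤ n) {σ : Store} {k : Fin n → ℤ} {A : ℝ} {i : Fin n}
    (h : Holds σ k A i) :
    ∃ τ, Leads K σ τ (604 * n) ∧
      (Function.update k i (zigzag (k i)) ∈ sampleIndices n →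
        Holds τ (Function.update k i (zigzag (k i)))
          (A + contrib K (Function.update k i (zigzag (k i)))) (n - 1)) ∧
      (Function.update k i (zigzag (k i)) ∉ sampleIndices n →
        Holds τ (Function.update k i 0) A (i - 1)) := by
  obtain ⟨τ, hτ, h1, h2⟩ := runs_visit (K := K) hn h
  refine ⟨τ, fun υ U hυ => (runs_loopStep ?_ hτ hυ).mono ?_, h1, h2⟩
  · simp [Test.holds, IExp.eval, h.active]
  · have : (Test.ile (.const 0) (.load (.const 1))).cost = 4 := rfl
    omega

/-- The position in the order `0, 1, -1, 2, -2, …`. -/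
def position (v : ℤ) : ℤ := if v ≤ 0 then -2 * v else 2 * v - 1

lemma position_zigzag (v : ℤ) : position (zigzag v) = position v + 1 := by
  unfold position zigzag; split_ifs <;> omega

lemma position_injective : Function.Injective position := by
  intro u v h
  unfold position at h; split_ifs at h <;> omega

lemma position_nonneg (v : ℤ) : 0 ≤ position v := by
  unfold position; split_ifs <;> omega

lemma abs_le_abs_of_position_le {u v : ℤ} (h : position u ≤ position v) : |u| ≤ |v| := by
  rw [abs_le', neg_le]
  rcases abs_cases v with ⟨h1, h2⟩ | ⟨h1, h2⟩ <;> unfold position at h <;>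
    split_ifs at h <;> omega

open Classical in
/-- The indices of sample points which agree with `k` in the first `j` coordinates. -/
def completions (hn : 1 ≤ n) (j : ℕ) (k : Fin n → ℤ) : Finset (Fin n → ℤ) :=
  (finite_sampleIndices hn).toFinset.filter fun l => ∀ i : Fin n, (i : ℕ) < j → l i = k i

lemma mem_completions {hn : 1 ≤ n} {j : ℕ} {k l : Fin n → ℤ} :
    l ∈ completions hn j k ↔ l ∈ sampleIndices n ∧ ∀ i : Fin n, (i : ℕ) < j → l i = k i := by
  simp [completions]

/-- Justifies the pruning: coordinates are tried in order of nondecreasing absolute value with zeros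
behind them, so a failure excludes every later candidate at that coordinate. -/
lemma mem_sampleIndices_of_abs_le (hn : 1 ≤ n) {k l : Fin n → ℤ} (hl : l ∈ sampleIndices n)
    (h : ∀ i, |k i| ≤ |l i|) : k ∈ sampleIndices n := by
  have hl' : ∑ i, excess n (l i) ^ 2 ≤ 4 * n := hl
  refine le_trans (Finset.sum_le_sum fun i _ => ?_) hl'
  have := excess_mono hn (h i)
  have := excess_nonneg n (k i)
  gcongr

/-- From a sample point whose coordinates from `j` on vanish, the enumeration visits all its other
completions and then activates the coordinate `j - 1`. -/
lemma leads_completions (hn : 1 ≤ n) (d j : ℕ) (hjd : j + d = n) {k : Fin n → ℤ}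
    (hk0 : ∀ i : Fin n, j ≤ i → k i = 0) (hk : k ∈ sampleIndices n) {σ : Store} {A : ℝ}
    (h : Holds σ k A (n - 1)) :
    ∃ τ, Leads K σ τ (604 * n * (d * (completions hn j k).card)) ∧
      Holds τ k (A + ∑ l ∈ completions hn j k, contrib K l - contrib K k) (j - 1) := by
  classical
  induction d generalizing j k σ A with
  | zero =>
    have hj : j = n := by omega
    have : completions hn j k = {k} := by
      ext l
      rw [mem_completions, Finset.mem_singleton]
      constructor
      · rintro ⟨-, hl⟩
        funext i
        exact hl i (by omega)
      · rintro rfl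
        exact ⟨hk, fun _ _ => rfl⟩
    refine ⟨σ, fun υ U hυ => hυ.mono (by omega), ?_⟩
    rw [this, Finset.sum_singleton, add_sub_cancel_right, hj]
    exact h
  | succ d ih =>
    set jf : Fin n := ⟨j, by omega⟩ with hjf
    -- The completions whose coordinate `j` comes at or after `v` in the order `0, 1, -1, …`. They
    -- split into the slice at `v` and the set for the successor of `v`.
    set later : ℤ → Finset (Fin n → ℤ) := fun v =>
      (completions hn j k).filter fun l => position v ≤ position (l jf) with hlater
    have hmem_later : ∀ v l, l ∈ later v ↔ (l ∈ sampleIndices n ∧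
        ∀ i : Fin n, (i : ℕ) < j → l i = k i) ∧ position v ≤ position (l jf) := by
      intro v l; rw [hlater, Finset.mem_filter, mem_completions]
    have hupd_lt : ∀ v (i : Fin n), (i : ℕ) < j → Function.update k jf v i = k i := by
      intro v i hi
      rw [Function.update_of_ne]
      rintro rfl
      simp [hjf] at hi
    have hupd_gt : ∀ v (i : Fin n), j + 1 ≤ i → Function.update k jf v i = 0 := by
      intro v i hi
      rw [Function.update_of_ne, hk0 i (by omega)]
      rintro rfl
      simp [hjf] at hi
    have hmem_compl : ∀ v l, l ∈ completions hn (j + 1) (Function.update k jf v) ↔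
        (l ∈ sampleIndices n ∧ ∀ i : Fin n, (i : ℕ) < j → l i = k i) ∧ l jf = v := by
      intro v l
      rw [mem_completions, and_assoc]
      refine and_congr_right fun _ => ⟨fun hl => ⟨fun i hi => ?_, ?_⟩, fun hl i hi => ?_⟩
      · rw [hl i (by omega), hupd_lt v i hi]
      · rw [hl jf (by simp [hjf]), Function.update_self]
      · rcases Nat.lt_succ_iff_lt_or_eq.1 hi with hi | hi
        · rw [hl.1 i hi, hupd_lt v i hi]
        · have : i = jf := Fin.ext hi
          rw [this, hl.2, Function.update_self]
    have hsplit : ∀ v, later v =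
        completions hn (j + 1) (Function.update k jf v) ∪ later (zigzag v) := by
      intro v
      ext l
      rw [Finset.mem_union, hmem_later, hmem_later, hmem_compl, position_zigzag, ← and_or_left]
      refine and_congr_right fun _ => ?_
      rw [← position_injective.eq_iff]
      omega
    have hdisj : ∀ v, Disjoint (completions hn (j + 1) (Function.update k jf v))
        (later (zigzag v)) := by
      intro v
      refine Finset.disjoint_left.2 fun l hl hl' => ?_
      have h1 := ((hmem_compl v l).1 hl).2
      have h2 := ((hmem_later _ l).1 hl').2
      rw [position_zigzag, h1] at h2
      omega
    -- An inner induction along the values of coordinate `j`. It terminates because each accepted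
    -- value has a nonempty slice, so the number of remaining completions drops.
    have key : ∀ (N : ℕ) (v : ℤ), (later v).card ≤ N → Function.update k jf v ∈ sampleIndices n →
        ∀ (σ : Store) (A : ℝ), Holds σ (Function.update k jf v) A (n - 1) →
        ∃ τ, Leads K σ τ (604 * n * ((d + 1) * (later v).card)) ∧
          Holds τ k (A + ∑ l ∈ later v, contrib K l - contrib K (Function.update k jf v))
            (j - 1) := by
      intro N
      induction N with
      | zero =>
        intro v hv hmem
        have : Function.update k jf v ∈ later v :=
          (hmem_later _ _).2 ⟨⟨hmem, hupd_lt v⟩, by rw [Function.update_self]⟩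
        rw [Nat.le_zero, Finset.card_eq_zero] at hv
        rw [hv] at this
        simp at this
      | succ N ihN =>
        intro v hv hmem σ A hσ
        have hself : Function.update k jf v ∈
            completions hn (j + 1) (Function.update k jf v) :=
          (hmem_compl _ _).2 ⟨⟨hmem, hupd_lt v⟩, Function.update_self _ _ _⟩
        have hpos := Finset.card_pos.2 ⟨_, hself⟩
        have hcard := Finset.card_union_of_disjoint (hdisj v)
        have hsum := Finset.sum_union (f := contrib K) (hdisj v)
        rw [← hsplit] at hcard hsum
        obtain ⟨τ, hτ, hτH⟩ := ih (j + 1) (by omega) (hupd_gt v) hmem hσ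
        have hact : Holds τ (Function.update k jf v)
            (A + ∑ l ∈ completions hn (j + 1) (Function.update k jf v), contrib K l -
              contrib K (Function.update k jf v)) jf := by
          convert hτH using 1
          push_cast; simp [hjf]
        obtain ⟨υ, hυ, hyes, hno⟩ := leads_visit (K := K) hn hact
        rw [Function.update_self] at hyes hno
        simp only [Function.update_idem] at hyes hno
        -- A slice costs `d` visits per completion plus the one visit to the next value. Since the
        -- slice contains at least one completion, this is at most `d + 1` visits per completion.
        by_cases hz : Function.update k jf (zigzag v) ∈ sampleIndices n
        · obtain ⟨ω, hω, hωH⟩ := ihN (zigzag v) (by omega) hz υ _ (hyes hz)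
          refine ⟨ω, ((hτ.trans hυ).trans hω).mono ?_, ?_⟩
          · rw [hcard]
            calc _ = 604 * n * (d * (completions hn (j + 1) (Function.update k jf v)).card + 1 +
                  (d + 1) * (later (zigzag v)).card) := by ring
              _ ≤ _ := by
                  gcongr
                  nlinarith
          · convert hωH using 1
            rw [hsum]; ring
        · have hempty : later (zigzag v) = ∅ := by
            refine Finset.eq_empty_of_forall_notMem fun l hl => hz ?_
            obtain ⟨⟨hl1, hl2⟩, hl3⟩ := (hmem_later _ _).1 hl
            refine mem_sampleIndices_of_abs_le hn hl1 fun i => ?_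
            rcases lt_trichotomy (i : ℕ) j with hi | hi | hi
            · rw [hupd_lt _ i hi, hl2 i hi]
            · have : i = jf := Fin.ext hi
              rw [this, Function.update_self]
              exact abs_le_abs_of_position_le hl3
            · rw [hupd_gt _ i hi]; simp
          refine ⟨υ, (hτ.trans hυ).mono ?_, ?_⟩
          · rw [hcard, hempty, Finset.card_empty]
            calc _ = 604 * n * (d * (completions hn (j + 1) (Function.update k jf v)).card + 1) := by
                  ring
              _ ≤ _ := by
                  gcongr
                  nlinarith
          · have := hno hz
            rw [show Function.update k jf 0 = k from by
              rw [← hk0 jf le_rfl, Function.update_eq_self]] at this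
            convert this using 1
            rw [hsum, hempty, Finset.sum_empty, add_zero]
    have hk' : Function.update k jf 0 = k := by
      rw [← hk0 jf le_rfl, Function.update_eq_self]
    have hl0 : later 0 = completions hn j k := by
      rw [hlater]
      exact Finset.filter_true_of_mem fun l _ => position_nonneg _
    have := key _ 0 le_rfl (by rwa [hk']) σ A (by rwa [hk'])
    rwa [hl0, hk'] at this

lemma zero_mem_sampleIndices (hn : 1 ≤ n) : (0 : Fin n → ℤ) ∈ sampleIndices n := by
  simp [sampleIndices, excess_zero hn]

lemma contrib_zero (K : Set (EuclideanSpace ℝ (Fin n))) : contrib K 0 = 0 := by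
  have : gridPoint (0 : Fin n → ℤ) = 0 := by ext i; simp
  rw [contrib, this, gauge_zero, mul_zero]

/-- The program computes the discrete estimate, in a time proportional to `n²` times the number of
sample points. -/
theorem outputs_estimator (hn : 1 ≤ n) (K : Set (EuclideanSpace ℝ (Fin n))) :
    ∃ t ≤ 700 * n ^ 2 * (finite_sampleIndices hn).toFinset.card,
      Outputs estimator K (ellTilde K) t := by
  set I := (finite_sampleIndices hn).toFinset with hI
  set σ₁ := (Store.init n).setReal 1 (scale n) with hσ₁
  set σ₂ := σ₁.setInt 1 (n - 1) with hσ₂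
  have hH : Holds σ₂ (0 : Fin n → ℤ) 0 (n - 1) := by
    refine ⟨?_, ?_, fun j => ?_, ?_, ?_⟩
    · simp [hσ₂, hσ₁, Store.setInt_int, Store.init]
    · simp [hσ₂, Store.setInt_int]
    · rw [hσ₂, Store.setInt_int, if_neg (by omega), hσ₁, Store.setReal_int]
      simp [Store.init]
    · simp [hσ₂, hσ₁, Store.setReal_real, Store.init]
    · simp [hσ₂, hσ₁, Store.setReal_real]
  obtain ⟨τ, hτ, hτH⟩ := leads_completions (K := K) (k := 0) hn n 0 (by omega) (fun _ _ => rfl)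
    (zero_mem_sampleIndices hn) hH
  have hcompl : completions hn 0 (0 : Fin n → ℤ) = I := by
    ext l
    simp [mem_completions, hI]
  rw [hcompl] at hτ hτH
  -- After all completions from coordinate `0` the active coordinate is `-1`, so the loop test
  -- fails.
  have hdone : Runs K enumerate τ τ 4 := by
    refine runs_loopDone ?_
    simp [Test.holds, IExp.eval, hτH.active]
  have hrun : Runs K estimator (Store.init n) τ
      (40 + (604 * n * (n * I.card) + 4)) := by
    have h1 : Runs K (.setReal (.const 1) scaleExp) (Store.init n) σ₁ 30 :=
      (runs_setReal rfl (eval_scaleExp (by simp [Store.init]))).mono (by decide)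
    have h2 : Runs K (.setInt (.const 1) (.minus (.load (.const 0)) (.const 1))) σ₁ σ₂ 10 :=
      (runs_setInt rfl (by simp [IExp.eval, hσ₁, Store.init])).mono (by decide)
    exact (h1.seq (h2.seq (hτ _ _ hdone))).mono (by omega)
  obtain ⟨t, ht, hex⟩ := hrun
  have hpos : 1 ≤ I.card := Finset.card_pos.2
    ⟨0, (finite_sampleIndices hn).mem_toFinset.2 (zero_mem_sampleIndices hn)⟩
  refine ⟨t, ht.trans ?_, τ, hex, ?_⟩
  · have h1 : 1 ≤ n ^ 2 * I.card := Nat.mul_pos (by positivity) hpos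
    calc _ = 604 * (n ^ 2 * I.card) + 44 := by ring
      _ ≤ 700 * (n ^ 2 * I.card) := by omega
      _ = _ := by ring
  -- The search starts at the origin without adding its contribution, which is zero because the
  -- gauge vanishes there.
  · rw [hτH.acc, contrib_zero, ellTilde_eq_sum hn]
    simp [contrib, hI]

lemma sq_le_four_pow (n : ℕ) : n ^ 2 ≤ 4 ^ n := by
  have : n ≤ 2 ^ n := n.lt_two_pow_self.le
  calc n ^ 2 ≤ (2 ^ n) ^ 2 := by gcongr
    _ = 4 ^ n := by rw [← pow_mul, mul_comm, pow_mul]; norm_num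

end EllEstimate
end

theorem mainTheorem4 :
    (∀ n : ℕ, 1 ≤ n →
      (EllEstimate.samplePoints n).Finite ∧
      ∀ K : Set (EuclideanSpace ℝ (Fin n)), EllEstimate.IsSymmConvexBody K →
        MeasureTheory.Integrable (fun x => gauge K x * EllEstimate.gaussDensity x) ∧
        (1 - 1 / EllEstimate.scale n) * EllEstimate.ell K ≤ EllEstimate.ellTilde K ∧
        EllEstimate.ellTilde K ≤ (1 + 1 / EllEstimate.scale n) * EllEstimate.ell K) ∧
    (∃ C : ℝ, 0 < C ∧
      (∀ n : ℕ, 2 ≤ n →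
        ((EllEstimate.samplePoints n).ncard : ℝ) ≤ (C * Real.sqrt (Real.log n)) ^ n) ∧
      ∃ program : EllEstimate.Cmd, ∀ n : ℕ, 1 ≤ n →
        ∀ K : Set (EuclideanSpace ℝ (Fin n)), EllEstimate.IsSymmConvexBody K →
          ∃ t : ℕ, EllEstimate.Outputs program K (EllEstimate.ellTilde K) t ∧
            (2 ≤ n → (t : ℝ) ≤ (C * Real.sqrt (Real.log n)) ^ n)) := by
  have hc := EllEstimate.countBase_pos
  refine ⟨fun n hn => ⟨EllEstimate.finite_samplePoints hn, fun K hK =>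
    ⟨hK.integrable_gauge_mul_gaussDensity, EllEstimate.ellTilde_bounds hn hK⟩⟩,
    2800 * EllEstimate.countBase, by positivity, fun n hn => ?_, EllEstimate.estimator,
    fun n hn K _ => ?_⟩
  · rw [EllEstimate.ncard_samplePoints (by omega)]
    refine (EllEstimate.card_sampleIndices_le_sqrt_log hn).trans ?_
    gcongr
    linarith
  · obtain ⟨t, ht, hout⟩ := EllEstimate.outputs_estimator hn K
    refine ⟨t, hout, fun hn2 => ?_⟩
    have h1 : (t : ℝ) ≤ 700 * (n : ℝ) ^ 2 *
        ((EllEstimate.finite_sampleIndices hn).toFinset.card : ℝ) := by exact_mod_cast ht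
    have h2 : (n : ℝ) ^ 2 ≤ 4 ^ n := by exact_mod_cast EllEstimate.sq_le_four_pow n
    -- The polynomial overhead enters the base of the power: `700 n² ≤ (700 · 4)ⁿ`, whence the
    -- `2800` in `C`.
    have h3 : (700 : ℝ) ≤ 700 ^ n := le_self_pow₀ (by norm_num) (by omega)
    calc (t : ℝ) ≤ 700 ^ n * 4 ^ n *
          (EllEstimate.countBase * Real.sqrt (Real.log n)) ^ n := by
          refine h1.trans ?_
          gcongr
          exact EllEstimate.card_sampleIndices_le_sqrt_log hn2
      _ = (2800 * EllEstimate.countBase * Real.sqrt (Real.log n)) ^ n := by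
          rw [← mul_pow, ← mul_pow]
          congr 1
          ring
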